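/- Let $k\in\mathbb N$. Rules for $k$-dimensional infinite chess consist of finitely many kinds of pieces, one of them the king, and, for each colour (white, black) and each kind, a finite list of ways to move. A way to move is given by a direction $v\in\mathbb Z^k\setminus\{0\}$, a range $r\in\mathbb N\cup\{\infty\}$, and the information whether it may be used for moves to vacant squares and whether it may be used for captures. It leads from a square $x\in\mathbb Z^k$ to the squares $x+mv$ with $1\le m\le r$ for which all squares $x+jv$, $0<j<m$, are vacant. (Range $1$ gives kings, knights and pawns; range $\infty$ gives rooks, bishops, queens and their higher-dimensional relatives.) Fix such rules. A position is a finite list of pieces, each with its colour, its kind and its location in $\mathbb Z^k$ or a mark that it has been captured, together with the player whose turn it is, such that the list contains at most one king of each colour and no two live pieces stand on the same square. A player is in check if the player has a live king and an opposing live piece could move so as to capture on its square (even if that opposing piece is pinned). In a legal move, the player whose turn it is moves one of that player's live pieces to a vacant square, or to a square with an opposing piece, which is then marked as captured, by a way to move that permits this, such that the player is not in check afterwards; then the turn passes. There is no promotion, castling, en passant, repetition rule or 50-move rule. A player is mated if it is that player's turn, the player is in check, and the player has no legal move. That player $c$ can force a win from $p$ in at most $n$ moves, counting only the moves of $c$,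 is defined recursively. For $n=0$ it means that the opponent is mated in $p$ and $c$ is not in check, or that it is $c$'s turn and the opponent is in check. For $n+1$ it means that $c$ can force a win from $p$ in at most $n$ moves; or it is $c$'s turn and $c$ has a legal move to a position from which $c$ can force a win in at most $n$ moves; or it is the opponent's turn, $c$ is not in check (otherwise $p$ is already won for the opponent), the opponent has a legal move, and after every legal move of the opponent $c$ has a legal move to a position from which $c$ can force a win in at most $n$ moves. Then the mate-in-$n$ problem of $k$-dimensional infinite chess with these rules is decidable, uniformly in the position and in $n$: there is an algorithm which, given a finite position $p$, a player $c$ and $n\in\mathbb N$, decides whether $c$ can force a win from $p$ in at most $n$ moves. -/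

import Mathlib

namespace InfiniteChess

/-- The two players. -/
inductive Color where
  | white : Color
  | black : Color

/-- The opponent of a player. -/
def Color.other : Color → Color
  | .white => .black
  | .black => .white

/-- The squares of the `k`-dimensional infinite edgeless board `ℤ^k`. -/
abbrev Square (k : ℕ) : Type := Fin k → ℤ

/-- One way in which a piece may move: from `x` to `x + m • dir`, where `1 ≤ m ≤ range`,
provided that the squares `x + j • dir` with `0 < j < m` are vacant. Leaps and single steps
(knight, king, pawn) have `range = 1`; the distance pieces (rook, bishop, queen, and so on) have
`range = ⊤`. The flags say whether this way of moving may be used to go to a vacant square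
(`quiet`) and whether it may be used to capture (`capture`); they differ for pawns. -/
structure MoveMode (k : ℕ) where
  dir : Square k
  dir_ne_zero : dir ≠ 0
  range : ℕ∞
  quiet : Bool
  capture : Bool

/-- Rules of piece movement for `k`-dimensional infinite chess: finitely many kinds of pieces, one
of which is the king, and for every colour and every kind a finite list of ways to move. -/
structure Rules (k : ℕ) where
  numKinds : ℕ
  king : Fin numKinds
  moves : Color → Fin numKinds → List (MoveMode k)

/-- A piece designation: the type of the piece (colour and kind) and its location, which is `none`
when the piece has been captured. -/
structure Designation (k N : ℕ) where
  color : Color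
  kind : Fin N
  loc : Option (Square k)

/-- A finite list of piece designations, with an indication of whose turn it is. -/
structure Position (k N : ℕ) where
  pieces : List (Designation k N)
  turn : Color

/-! ### Finite codes, to make sense of computability -/

/-- Colours are coded as Booleans. -/
def Color.equivBool : Color ≃ Bool where
  toFun c := match c with
    | .white => true
    | .black => false
  invFun b := match b with
    | true => .white
    | false => .black
  left_inv c := by cases c <;> rfl
  right_inv b := by cases b <;> rfl

instance : Primcodable Color := Primcodable.ofEquiv Bool Color.equivBool

/-- Piece designations are coded as triples. -/
def Designation.equivProd (k N : ℕ) :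
    Designation k N ≃ Color × Fin N × Option (Square k) where
  toFun d := (d.color, d.kind, d.loc)
  invFun t := ⟨t.1, t.2.1, t.2.2⟩
  left_inv _ := rfl
  right_inv _ := rfl

instance (k N : ℕ) : Primcodable (Designation k N) :=
  Primcodable.ofEquiv (Color × Fin N × Option (Square k)) (Designation.equivProd k N)

/-- Positions are coded as pairs. -/
def Position.equivProd (k N : ℕ) :
    Position k N ≃ List (Designation k N) × Color where
  toFun p := (p.pieces, p.turn)
  invFun t := ⟨t.1, t.2⟩
  left_inv _ := rfl
  right_inv _ := rfl

instance (k N : ℕ) : Primcodable (Position k N) :=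
  Primcodable.ofEquiv (List (Designation k N) × Color) (Position.equivProd k N)

/-! ### The rules of the game -/

variable {k : ℕ}

/-- Some live piece stands on the square `s`. -/
def Position.Occupied {N : ℕ} (p : Position k N) (s : Square k) : Prop :=
  ∃ d ∈ p.pieces, d.loc = some s

/-- A listing is a genuine position if it contains at most one king of each colour and no two live
pieces stand on the same square. -/
def Rules.IsPosition (R : Rules k) (p : Position k R.numKinds) : Prop :=
  p.pieces.Pairwise (fun d e => ¬ (d.kind = R.king ∧ e.kind = R.king ∧ d.color = e.color)) ∧
  p.pieces.Pairwise (fun d e => ∀ s, ¬ (d.loc = some s ∧ e.loc = some s))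

/-- The way of moving `μ` leads from `x` to `y`, with no obstructing piece in between. -/
def MoveMode.Reaches {N : ℕ} (μ : MoveMode k) (p : Position k N) (x y : Square k) : Prop :=
  ∃ m : ℕ, 1 ≤ m ∧ (m : ℕ∞) ≤ μ.range ∧ y = x + m • μ.dir ∧
    ∀ j : ℕ, 0 < j → j < m → ¬ p.Occupied (x + j • μ.dir)

/-- The live piece `d` could move so as to capture an opposing piece on the square `y`, regardless
of what stands on `y` and of pins. -/
def Rules.Attacks (R : Rules k) (p : Position k R.numKinds) (d : Designation k R.numKinds)
    (y : Square k) : Prop :=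
  ∃ x, d.loc = some x ∧ ∃ μ ∈ R.moves d.color d.kind, μ.capture = true ∧ μ.Reaches p x y

/-- The player `c` has a live king, and it is attacked by an opposing piece. -/
def Rules.InCheck (R : Rules k) (p : Position k R.numKinds) (c : Color) : Prop :=
  ∃ a ∈ p.pieces, a.color = c ∧ a.kind = R.king ∧ ∃ s, a.loc = some s ∧
    ∃ b ∈ p.pieces, b.color = c.other ∧ R.Attacks p b s

/-- The position after the `i`-th piece of `p` has moved to the square `y`: a piece that stood
on `y` is marked as captured, the order of the listing is kept, and the turn passes. -/
def Position.after {N : ℕ} (p : Position k N) (i : ℕ) (y : Square k) : Position k N where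
  pieces := p.pieces.mapIdx fun j d =>
    if j = i then ⟨d.color, d.kind, some y⟩
    else if d.loc = some y then ⟨d.color, d.kind, none⟩
    else d
  turn := p.turn.other

/-- A legal move of the player whose turn it is transforms `p` into `q`: one of the player's live
pieces moves to a vacant square or captures an opposing piece, and the player is then not in
check. -/
def Rules.OneMove (R : Rules k) (p q : Position k R.numKinds) : Prop :=
  ∃ (i : ℕ) (d : Designation k R.numKinds) (x y : Square k),
    p.pieces[i]? = some d ∧ d.color = p.turn ∧ d.loc = some x ∧
    (∃ μ ∈ R.moves d.color d.kind, μ.Reaches p x y ∧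
      ((μ.quiet = true ∧ ¬ p.Occupied y) ∨
        (μ.capture = true ∧ ∃ e ∈ p.pieces, e.color = d.color.other ∧ e.loc = some y))) ∧
    q = p.after i y ∧ ¬ R.InCheck q p.turn

/-- The player `c` is to play, is in check, and has no legal move. -/
def Rules.Mated (R : Rules k) (p : Position k R.numKinds) (c : Color) : Prop :=
  p.turn = c ∧ R.InCheck p c ∧ ¬ ∃ q, R.OneMove p q

/-- The player `c` can force a win from `p` in at most `n` moves, where only the moves of `c` are
counted. A position in which the player to move attacks the opposing king is already won for that
player, even if that player is in checkmate; so there the opponent has nothing to force. -/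
def Rules.WinsIn (R : Rules k) (c : Color) : ℕ → Position k R.numKinds → Prop
  | 0, p =>
      (R.Mated p c.other ∧ ¬ R.InCheck p c) ∨ (p.turn = c ∧ R.InCheck p c.other)
  | n + 1, p =>
      R.WinsIn c n p ∨
      (p.turn = c ∧ ∃ q, R.OneMove p q ∧ R.WinsIn c n q) ∨
      (p.turn = c.other ∧ ¬ R.InCheck p c ∧ (∃ q, R.OneMove p q) ∧
        ∀ q, R.OneMove p q → ∃ r, R.OneMove q r ∧ R.WinsIn c n r)

/-- The mate-in-`n` problem: an instance consists of a position, a designated player and a number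
`n`, and the question is whether that player can force a win from that position in at most `n`
moves. -/
def Rules.MateIn (R : Rules k) (x : Position k R.numKinds × Color × ℕ) : Prop :=
  R.IsPosition x.1 ∧ R.WinsIn x.2.1 x.2.2 x.1

end InfiniteChess

/-! Once the piece and the way of moving are chosen, a move is a natural number, its distance. The
conditions of the game compare integer combinations of coordinates and distances with fixed small
coefficients. A win in `n` moves is thus a statement of Presburger arithmetic with boundedly many
quantifiers, and quantifier elimination is carried out here as a back-and-forth argument.

A set `G` of pairs matches numbers on one board with numbers on another. `Sim N G` says that matched
signed sums of at most `N` entries are congruent modulo `N!` and either equal or beyond `N` on the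
same side. By `Sim.exists_insert`, if `G` is similar to precision `refine N`, then every `m` has a
partner `m'` such that adding the pair leaves precision `N`, and `m'` is bounded linearly in the
numbers on the second board. Iteration along the quantifiers gives `winsIn_transfer`: matched
positions of precision level `2 * n + 3` have the same wins in `n` moves. Two levels pay for the two
plies of a round; the last three pay for a move, the distance of an attack and an obstructed square.

When a position is matched with itself, each legal move is replaced by one of bounded distance to a
similar position (`Rules.exists_boundedMove`). Hence bounding all moves does not change the winner
(`Rules.winsIn_iff_boundedWin`). The bounded game is finitely branching, with a bound primitive
recursive in `n` and the position, so it is evaluated by primitive recursion. -/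

namespace InfiniteChess

/-! ### Simultaneous integer combinations and similarity -/

/-- `Comb G n x`: the pair `x` is a sum of at most `n` pairs from `G` and their negatives. -/
inductive Comb (G : Set (ℤ × ℤ)) : ℕ → ℤ × ℤ → Prop
  | zero (n : ℕ) : Comb G n 0
  | add {n : ℕ} {x g : ℤ × ℤ} : Comb G n x → g ∈ G → Comb G (n + 1) (x + g)
  | sub {n : ℕ} {x g : ℤ × ℤ} : Comb G n x → g ∈ G → Comb G (n + 1) (x - g)

/-! ### Calculus of bounded combinations -/

namespace Comb

variable {G G' : Set (ℤ × ℤ)} {n n' : ℕ} {x y : ℤ × ℤ}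

theorem mono (h : Comb G n x) (hn : n ≤ n') : Comb G n' x := by
  induction h generalizing n' with
  | zero => exact .zero _
  | add _ hg ih =>
    obtain ⟨j, rfl⟩ : ∃ j, n' = j + 1 := ⟨n' - 1, by omega⟩
    exact .add (ih (by omega)) hg
  | sub _ hg ih =>
    obtain ⟨j, rfl⟩ : ∃ j, n' = j + 1 := ⟨n' - 1, by omega⟩
    exact .sub (ih (by omega)) hg

theorem single (h : x ∈ G) : Comb G 1 x := by
  simpa using Comb.add (.zero 0) h

theorem plus (hx : Comb G n x) (hy : Comb G n' y) : Comb G (n + n') (x + y) := by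
  induction hy with
  | zero => simpa using hx.mono (by omega)
  | add _ hg ih => exact add_assoc x _ _ ▸ Comb.add ih hg
  | sub _ hg ih => rw [← add_sub_assoc]; exact .sub ih hg

theorem neg (hx : Comb G n x) : Comb G n (-x) := by
  induction hx with
  | zero => simpa using Comb.zero _
  | add _ hg ih => rw [neg_add]; exact .sub ih hg
  | sub _ hg ih => rw [neg_sub', sub_neg_eq_add]; exact .add ih hg

theorem nsmul (hx : Comb G n x) (a : ℕ) : Comb G (a * n) (a • x) := by
  induction a with
  | zero => simpa using Comb.zero _
  | succ a ih => rw [succ_nsmul, Nat.succ_mul]; exact ih.plus hx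

theorem zsmul (hx : Comb G n x) (a : ℤ) : Comb G (a.natAbs * n) (a • x) := by
  obtain ⟨b, rfl | rfl⟩ := a.eq_nat_or_neg
  · simpa using hx.nsmul b
  · simpa using (hx.nsmul b).neg

theorem trans {w : ℕ} (hG : ∀ g ∈ G', Comb G w g) (hx : Comb G' n x) : Comb G (w * n) x := by
  induction hx with
  | zero => exact .zero _
  | add _ hg ih => exact ih.plus (hG _ hg)
  | sub _ hg ih => rw [sub_eq_add_neg]; exact ih.plus (hG _ hg).neg

/-- Isolates the coefficient of a new pair, so that combinations become linear forms in the number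
being quantified. -/
theorem of_insert {g : ℤ × ℤ} (hx : Comb (insert g G) n x) :
    ∃ (y : ℤ × ℤ) (e : ℤ), Comb G n y ∧ e.natAbs ≤ n ∧ x = y + e • g := by
  induction hx with
  | zero => exact ⟨0, 0, .zero _, by simp, by simp⟩
  | add _ hg ih =>
    obtain ⟨y, e, hy, he, rfl⟩ := ih
    rcases hg with rfl | hg
    · exact ⟨y, e + 1, hy.mono (by omega), by omega, by rw [add_smul, one_smul, add_assoc]⟩
    · exact ⟨y + _, e, .add hy hg, by omega, by abel⟩
  | sub _ hg ih =>
    obtain ⟨y, e, hy, he, rfl⟩ := ih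
    rcases hg with rfl | hg
    · exact ⟨y, e - 1, hy.mono (by omega), by omega, by rw [sub_smul, one_smul, add_sub_assoc]⟩
    · exact ⟨y - _, e, .sub hy hg, by omega, by abel⟩

theorem abs_snd_le {S : ℕ} (hG : ∀ g ∈ G, |g.2| ≤ S) (hx : Comb G n x) : |x.2| ≤ n * S := by
  induction hx with
  | zero => simp; positivity
  | add _ hg ih =>
    have := hG _ hg
    push_cast
    rw [Prod.snd_add, add_mul, one_mul]
    exact (abs_add_le _ _).trans (add_le_add ih this)
  | sub _ hg ih =>
    have := hG _ hg
    push_cast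
    rw [Prod.snd_sub, add_mul, one_mul]
    exact (abs_sub _ _).trans (add_le_add ih this)

theorem swap (hx : Comb G n x) : Comb (Prod.swap '' G) n x.swap := by
  induction hx with
  | zero => exact .zero _
  | add _ hg ih => exact .add ih (Set.mem_image_of_mem _ hg)
  | sub _ hg ih => exact .sub ih (Set.mem_image_of_mem _ hg)

end Comb

/-- Two integers that are congruent modulo `N!` and either equal or beyond `N` on the same side. -/
def Close (N : ℕ) (u v : ℤ) : Prop :=
  ((N.factorial : ℕ) : ℤ) ∣ u - v ∧
    (u = v ∨ ((N : ℤ) < u ∧ (N : ℤ) < v) ∨ (u < -(N : ℤ) ∧ v < -(N : ℤ)))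

theorem Close.refl (N : ℕ) (u : ℤ) : Close N u u := ⟨by simp, .inl rfl⟩

theorem Close.symm {N : ℕ} {u v : ℤ} (h : Close N u v) : Close N v u :=
  ⟨by rw [← neg_sub]; exact (dvd_neg).2 h.1, by have := h.2; tauto⟩

theorem Close.trans {N : ℕ} {u v w : ℤ} (h : Close N u v) (h' : Close N v w) : Close N u w :=
  ⟨by have := dvd_add h.1 h'.1; simpa using this, by have := h.2; have := h'.2; omega⟩

theorem Close.mono {N N' : ℕ} {u v : ℤ} (h : Close N' u v) (hN : N ≤ N') : Close N u v :=
  ⟨(Int.natCast_dvd_natCast.2 (Nat.factorial_dvd_factorial hN)).trans h.1,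
    by have := h.2; omega⟩

/-- The two components of `G` are indistinguishable by integer combinations of size at most `N`. -/
def Sim (N : ℕ) (G : Set (ℤ × ℤ)) : Prop := ∀ x, Comb G N x → Close N x.1 x.2

theorem Sim.mono {N N' : ℕ} {G : Set (ℤ × ℤ)} (h : Sim N' G) (hN : N ≤ N') : Sim N G :=
  fun x hx => (h x (hx.mono hN)).mono hN

theorem Sim.trans {N N' w : ℕ} {G G' : Set (ℤ × ℤ)} (h : Sim N' G) (hG : ∀ g ∈ G', Comb G w g)
    (hN : N ≤ N') (hw : w * N ≤ N') : Sim N G' :=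
  fun x hx => (h x ((Comb.trans hG hx).mono hw)).mono hN

theorem Sim.swap {N : ℕ} {G : Set (ℤ × ℤ)} (h : Sim N G) : Sim N (Prod.swap '' G) := by
  intro x hx
  have := hx.swap
  rw [Set.image_image] at this
  simp only [Prod.swap_swap, Set.image_id'] at this
  exact (h _ this).symm

theorem Sim.diagonal {N : ℕ} {G : Set (ℤ × ℤ)} (h : ∀ g ∈ G, g.1 = g.2) : Sim N G := by
  intro x hx
  suffices x.1 = x.2 by rw [this]; exact .refl _ _
  induction hx with
  | zero => rfl
  | add _ hg ih => simp [ih, h _ hg]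
  | sub _ hg ih => simp [ih, h _ hg]

/-- How far from a given form a quantified number has to be looked for. -/
def near (N : ℕ) : ℕ := N + N * N.factorial

/-- Descent on `m` in steps of `N!`. As long as no nonconstant form is near zero, a step keeps every
form in its residue class and beyond `N` on its side. The descent stops when some form is near zero,
and that form then pins `m₀` down. -/
theorem exists_near {N : ℕ} (hN : 1 ≤ N) (G : Set (ℤ × ℤ)) (m : ℕ) :
    ∃ m₀ : ℕ, (∃ (x : ℤ × ℤ) (e : ℤ), Comb G N x ∧ e ≠ 0 ∧ e.natAbs ≤ N ∧
        |x.1 + e * m₀| ≤ near N) ∧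
      ∀ (x : ℤ × ℤ) (e : ℤ), Comb G N x → e.natAbs ≤ N →
        Close N (x.1 + e * m) (x.1 + e * m₀) := by
  induction m using Nat.strong_induction_on with
  | _ m ih =>
  by_cases hm : ∃ (x : ℤ × ℤ) (e : ℤ), Comb G N x ∧ e ≠ 0 ∧ e.natAbs ≤ N ∧ |x.1 + e * m| ≤ near N
  · exact ⟨m, hm, fun _ _ _ _ => .refl _ _⟩
  have hM := N.factorial_pos
  have hlt : N.factorial < m := by
    by_contra hlt
    -- The form `m` itself is not near zero, so `N!` can be subtracted within ℕ.
    refine hm ⟨0, 1, .zero _, one_ne_zero, by simpa using hN, ?_⟩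
    have : m ≤ near N := by unfold near; nlinarith
    simpa using this
  obtain ⟨m₀, h₀, hc⟩ := ih (m - N.factorial) (by omega)
  refine ⟨m₀, h₀, fun x e hx he => Close.trans ?_ (hc x e hx he)⟩
  rcases eq_or_ne e 0 with rfl | he0
  · simpa using Close.refl _ _
  have hfar : (near N : ℤ) < |x.1 + e * m| := not_le.1 fun h => hm ⟨x, e, hx, he0, he, h⟩
  have hdiff : x.1 + e * ((m - N.factorial : ℕ) : ℤ) = x.1 + e * m - e * N.factorial := by
    push_cast [Nat.cast_sub hlt.le]; ring
  -- One step changes a form by at most `N * N!`, which is exactly the margin of `near N` over `N`.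
  have hb : |e * (N.factorial : ℤ)| ≤ N * N.factorial := by
    rw [abs_mul, Nat.abs_cast]
    have : |e| ≤ N := by rw [Int.abs_eq_natAbs]; exact_mod_cast he
    gcongr
  rw [hdiff]
  refine ⟨⟨e, by ring⟩, .inr ?_⟩
  rw [near] at hfar
  push_cast at hfar
  have hb' := abs_le.1 hb
  rcases lt_abs.1 hfar with h | h
  · left; constructor <;> nlinarith
  · right; constructor <;> nlinarith

/-- The precision with which one quantifier is eliminated to the precision `N`. -/
def refine (N : ℕ) : ℕ := 2 * N * N + N * N * N.factorial + N

/-- Elimination of one quantifier over the natural numbers, with a bound on the witness. -/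
theorem Sim.exists_insert {N : ℕ} (hN : 1 ≤ N) {G : Set (ℤ × ℤ)} (h : Sim (refine N) G) (m : ℕ) :
    ∃ m' : ℕ, Sim N (insert ((m : ℤ), (m' : ℤ)) G) ∧
      ∀ S : ℕ, (∀ g ∈ G, |g.2| ≤ S) → m' ≤ refine N * (S + 1) := by
  obtain ⟨m₀, ⟨x₀, e₀, hx₀, he₀, heN, ht⟩, hc⟩ := exists_near hN G m
  set N' := refine N with hN'
  -- The first two terms equal `N * near N + N * N`, the margin needed for cancelling `e₀`; `2 * N *
  -- N` alone bounds the size of the combinations used.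
  have hle1 : 2 * N * N + N * N * N.factorial + N ≤ N' := by rw [hN', refine]
  have hNN : N ≤ N * N := Nat.le_mul_of_pos_left _ hN
  have hle0 : N ≤ N' := by omega
  -- The partner is defined by giving the near form the same value `t` on both boards. This equation
  -- is solvable because `e₀` divides `N'!`, hence the difference of the constant terms.
  obtain ⟨d, hd⟩ : e₀ ∣ x₀.1 - x₀.2 := by
    refine dvd_trans ?_ (h x₀ (hx₀.mono hle0)).1
    rw [← Int.natAbs_dvd]
    exact Int.natCast_dvd_natCast.2
      (Nat.dvd_factorial (Int.natAbs_pos.2 he₀) (heN.trans hle0))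
  set t := x₀.1 + e₀ * m₀ with ht'
  have ht2 : x₀.2 + e₀ * (m₀ + d) = t := by rw [mul_add, ← hd, ht']; ring
  have heN' : |e₀| ≤ N := by rw [Int.abs_eq_natAbs]; exact_mod_cast heN
  have hone : 1 ≤ |e₀| := Int.one_le_abs he₀
  have hsim : Sim N (insert ((m : ℤ), (m₀ : ℤ) + d) G) := by
    intro x hx
    obtain ⟨y, e, hy, he, rfl⟩ := hx.of_insert
    have heN2 : |e| ≤ N := by rw [Int.abs_eq_natAbs]; exact_mod_cast he
    simp only [Prod.fst_add, Prod.smul_fst, smul_eq_mul, Prod.snd_add, Prod.smul_snd]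
    refine (hc y e hy he).trans ?_
    set z := y.1 + e * m₀ with hz
    set z' := y.2 + e * (m₀ + d) with hz'
    -- Cross-multiplying with the near form eliminates the new number: what remains is a combination
    -- over `G`, equal to `e₀ * z - e * t` on one board and `e₀ * z' - e * t` on the other.
    have hw : Comb G N' (e₀ • y + (-e) • x₀) := by
      refine ((hy.zsmul e₀).plus (hx₀.zsmul (-e))).mono ?_
      rw [Int.natAbs_neg]
      nlinarith
    obtain ⟨hdvd, htri⟩ := h _ hw
    simp only [Prod.fst_add, Prod.smul_fst, smul_eq_mul, Prod.snd_add, Prod.smul_snd] at hdvd htri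
    have h1 : e₀ * y.1 + -e * x₀.1 = e₀ * z - e * t := by rw [hz, ht']; ring
    have h2 : e₀ * y.2 + -e * x₀.2 = e₀ * z' - e * t := by rw [hz', ← ht2]; ring
    rw [h1, h2] at hdvd htri
    constructor
    -- To cancel `e₀` modulo `N!`, use that `e₀ * N!` divides `N! * N!`, which divides `(2N)!`.
    · rw [show e₀ * z - e * t - (e₀ * z' - e * t) = e₀ * (z - z') by ring] at hdvd
      refine Int.dvd_of_mul_dvd_mul_left he₀ (dvd_trans ?_ hdvd)
      rw [← Int.natAbs_dvd, Int.natAbs_mul, Int.natAbs_natCast]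
      refine Int.natCast_dvd_natCast.2 ?_
      calc e₀.natAbs * N.factorial ∣ N.factorial * N.factorial :=
            Nat.mul_dvd_mul_right (Nat.dvd_factorial (Int.natAbs_pos.2 he₀) heN) _
        _ ∣ (N + N).factorial := Nat.factorial_mul_factorial_dvd_factorial_add _ _
        _ ∣ _ := Nat.factorial_dvd_factorial (by nlinarith)
    · have het : |e * t| ≤ N * near N := by
        rw [abs_mul]; gcongr
      have het' := abs_le.1 het
      have hbig : (N * near N + N * N : ℤ) ≤ N' := by
        have : N * near N + N * N ≤ N' := by rw [near]; nlinarith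
        exact_mod_cast this
      -- Dividing by `e₀` costs at most a factor `N`; the resulting side depends only on the sign of
      -- `e₀`, so it is the same for `z` and `z'`.
      have key : ∀ s : ℤ, (N : ℤ) * N < e₀ * s → (0 < e₀ ∧ N < s) ∨ (e₀ < 0 ∧ s < -N) := by
        intro s hs
        rcases lt_or_gt_of_ne he₀ with h | h
        · right
          rw [abs_of_neg h] at heN'
          refine ⟨h, ?_⟩
          by_contra hcon
          nlinarith
        · left
          rw [abs_of_pos h] at heN'
          refine ⟨h, ?_⟩
          by_contra hcon
          nlinarith
      rcases htri with heq | ⟨ha, hb⟩ | ⟨ha, hb⟩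
      · left; exact mul_left_cancel₀ he₀ (by linarith)
      · right
        have ka := key z (by linarith)
        have kb := key z' (by linarith)
        omega
      · right
        have ka := key (-z) (by linarith)
        have kb := key (-z') (by linarith)
        omega
  -- The new pair is itself a combination, and its first entry `m` is nonnegative.
  have hnn : 0 ≤ (m₀ : ℤ) + d := by
    have := (hsim _ ((Comb.single (Set.mem_insert _ _)).mono hN)).2
    simp only at this
    omega
  obtain ⟨m', hm'⟩ := Int.eq_ofNat_of_zero_le hnn
  rw [hm'] at hsim ht2
  refine ⟨m', hsim, fun S hS => ?_⟩
  have hx2 := hx₀.abs_snd_le hS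
  have h3 : (m' : ℤ) ≤ |e₀ * m'| := by
    rw [abs_mul, Nat.abs_cast]; nlinarith
  -- The near form on the second board is solved for `m'`.
  have h4 : |e₀ * (m' : ℤ)| ≤ near N + N * S := by
    rw [show e₀ * (m' : ℤ) = t - x₀.2 by linarith]
    exact (abs_sub _ _).trans (add_le_add ht hx2)
  have h5 : m' ≤ near N + N * S := by exact_mod_cast h3.trans h4
  refine h5.trans ?_
  have h6 : near N ≤ N' := by rw [near]; nlinarith [N.factorial_pos]
  nlinarith

end InfiniteChess

namespace InfiniteChess

variable {k : ℕ}

/-! ### Transfer of the rules between similar positions -/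

/-- A number that exceeds all numbers occurring in the rules. -/
def Rules.width (R : Rules k) : ℕ :=
  2 + ∑ t, (((R.moves .white t ++ R.moves .black t).map
    fun μ => μ.range.toNat + ∑ l, (μ.dir l).natAbs)).sum

theorem Rules.le_width (R : Rules k) {c : Color} {t : Fin R.numKinds} {μ : MoveMode k}
    (hμ : μ ∈ R.moves c t) : 2 + (μ.range.toNat + ∑ l, (μ.dir l).natAbs) ≤ R.width := by
  refine Nat.add_le_add_left (le_trans ?_ (Finset.single_le_sum (fun _ _ => Nat.zero_le _)
    (Finset.mem_univ t))) 2
  refine List.le_sum_of_mem (List.mem_map.2 ⟨μ, ?_, rfl⟩)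
  cases c <;> simp [hμ]

theorem Rules.natAbs_dir_lt_width (R : Rules k) {c : Color} {t : Fin R.numKinds} {μ : MoveMode k}
    (hμ : μ ∈ R.moves c t) (l : Fin k) : (μ.dir l).natAbs + 1 ≤ R.width := by
  have := R.le_width hμ
  have := Finset.single_le_sum (f := fun l => (μ.dir l).natAbs) (fun _ _ => Nat.zero_le _)
    (Finset.mem_univ l)
  omega

/-- The precision that suffices for the elimination of `r` quantifiers. -/
def precision (W : ℕ) : ℕ → ℕ
  | 0 => W
  | r + 1 => refine (W * precision W r)

theorem le_refine (N : ℕ) : N ≤ refine N := by unfold refine; omega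

theorem precision_le_succ {W : ℕ} (hW : 2 ≤ W) (r : ℕ) : precision W r ≤ precision W (r + 1) :=
  (Nat.le_mul_of_pos_left _ (by omega)).trans (le_refine _)

theorem precision_mono {W : ℕ} (hW : 2 ≤ W) : Monotone (precision W) :=
  monotone_nat_of_le_succ (precision_le_succ hW)

theorem le_precision {W : ℕ} (hW : 2 ≤ W) (r : ℕ) : W ≤ precision W r :=
  precision_mono hW (Nat.zero_le r)

theorem Rules.two_le_width (R : Rules k) : 2 ≤ R.width := Nat.le_add_right _ _

/-- Elimination of a quantifier, with closure under small multiples of the new element. -/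
theorem Sim.exists_extension {W r : ℕ} (hW : 2 ≤ W) {G : Set (ℤ × ℤ)}
    (h : Sim (precision W (r + 1)) G) (m : ℕ) :
    ∃ (m' : ℕ) (G' : Set (ℤ × ℤ)), Sim (precision W r) G' ∧ G ⊆ G' ∧ ((m : ℤ), (m' : ℤ)) ∈ G' ∧
      (∀ g ∈ G, ∀ v : ℤ, v.natAbs + 1 ≤ W → g + v • ((m : ℤ), (m' : ℤ)) ∈ G') ∧
      ∀ S : ℕ, (∀ g ∈ G, |g.2| ≤ S) → m' ≤ precision W (r + 1) * (S + 1) := by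
  have hp := le_precision hW r
  -- The factor `W` pays for closing under combinations of size `W`, among them the coordinates
  -- after a move along a direction of the rules.
  obtain ⟨m', hm', hS⟩ := Sim.exists_insert (N := W * precision W r) (by nlinarith) h m
  refine ⟨m', {g | Comb (insert ((m : ℤ), (m' : ℤ)) G) W g},
    hm'.trans (fun g hg => hg) (Nat.le_mul_of_pos_left _ (by omega)) le_rfl, ?_, ?_, ?_, hS⟩
  · exact fun g hg => (Comb.single (Set.mem_insert_of_mem _ hg)).mono (by omega)
  · exact (Comb.single (Set.mem_insert _ _)).mono (by omega)
  · intro g hg v hv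
    refine ((Comb.single (Set.mem_insert_of_mem _ hg)).plus
      ((Comb.single (Set.mem_insert _ _)).zsmul v)).mono (by omega)

/-- A difference is a combination of size two, so precision two already preserves equality and order
of matched numbers. -/
theorem Sim.sub_close {N : ℕ} (hN : 2 ≤ N) {G : Set (ℤ × ℤ)} (h : Sim N G) {g g' : ℤ × ℤ}
    (hg : g ∈ G) (hg' : g' ∈ G) : Close N (g.1 - g'.1) (g.2 - g'.2) := by
  have := h _ (((Comb.single hg).plus (Comb.single hg').neg).mono hN)
  simpa [sub_eq_add_neg] using this

theorem Sim.eq_iff {N : ℕ} (hN : 2 ≤ N) {G : Set (ℤ × ℤ)} (h : Sim N G) {g g' : ℤ × ℤ}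
    (hg : g ∈ G) (hg' : g' ∈ G) : g.1 = g'.1 ↔ g.2 = g'.2 := by
  have := (h.sub_close hN hg hg').2
  omega

theorem Sim.lt_iff {N : ℕ} (hN : 2 ≤ N) {G : Set (ℤ × ℤ)} (h : Sim N G) {g g' : ℤ × ℤ}
    (hg : g ∈ G) (hg' : g' ∈ G) : g.1 < g'.1 ↔ g.2 < g'.2 := by
  have := (h.sub_close hN hg hg').2
  omega

/-- Corresponding squares. -/
def SquareSim (G : Set (ℤ × ℤ)) (x x' : Square k) : Prop := ∀ l, (x l, x' l) ∈ G

theorem SquareSim.mono {G G' : Set (ℤ × ℤ)} {x x' : Square k} (h : SquareSim G x x')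
    (hG : G ⊆ G') : SquareSim G' x x' := fun l => hG (h l)

theorem SquareSim.swap {G : Set (ℤ × ℤ)} {x x' : Square k} (h : SquareSim G x x') :
    SquareSim (Prod.swap '' G) x' x := fun l => ⟨_, h l, rfl⟩

theorem SquareSim.eq_iff {N : ℕ} (hN : 2 ≤ N) {G : Set (ℤ × ℤ)} (hG : Sim N G)
    {x x' y y' : Square k} (hx : SquareSim G x x') (hy : SquareSim G y y') :
    x = y ↔ x' = y' := by
  rw [funext_iff, funext_iff]
  exact forall_congr' fun l => hG.eq_iff hN (hx l) (hy l)

/-- Corresponding piece designations. -/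
structure DesignationSim (G : Set (ℤ × ℤ)) {N : ℕ} (d d' : Designation k N) : Prop where
  color : d.color = d'.color
  kind : d.kind = d'.kind
  loc : Option.Rel (SquareSim G) d.loc d'.loc

theorem DesignationSim.mono {G G' : Set (ℤ × ℤ)} {N : ℕ} {d d' : Designation k N}
    (h : DesignationSim G d d') (hG : G ⊆ G') : DesignationSim G' d d' := by
  refine ⟨h.color, h.kind, ?_⟩
  have := h.loc
  generalize d.loc = o, d'.loc = o' at this
  cases this with
  | some h => exact .some (h.mono hG)
  | none => exact .none

theorem DesignationSim.swap {G : Set (ℤ × ℤ)} {N : ℕ} {d d' : Designation k N}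
    (h : DesignationSim G d d') : DesignationSim (Prod.swap '' G) d' d := by
  refine ⟨h.color.symm, h.kind.symm, ?_⟩
  have := h.loc
  generalize d.loc = o, d'.loc = o' at this
  cases this with
  | some h => exact .some h.swap
  | none => exact .none

theorem DesignationSim.exists_loc {G : Set (ℤ × ℤ)} {N : ℕ} {d d' : Designation k N}
    (h : DesignationSim G d d') {x : Square k} (hx : d.loc = some x) :
    ∃ x', d'.loc = some x' ∧ SquareSim G x x' := by
  have := h.loc
  rw [hx] at this
  generalize d'.loc = o at this
  cases this with
  | some h => exact ⟨_, rfl, h⟩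

theorem DesignationSim.loc_eq_iff {G : Set (ℤ × ℤ)} {N M : ℕ} (hM : 2 ≤ M) (hG : Sim M G)
    {d d' : Designation k N} (h : DesignationSim G d d') {y y' : Square k}
    (hy : SquareSim G y y') : d.loc = some y ↔ d'.loc = some y' := by
  have := h.loc
  generalize d.loc = o, d'.loc = o' at this ⊢
  cases this with
  | some h => simpa using h.eq_iff hM hG hy
  | none => simp

/-- Corresponding positions. -/
structure PositionSim (G : Set (ℤ × ℤ)) {N : ℕ} (p p' : Position k N) : Prop where
  turn : p.turn = p'.turn
  length : p.pieces.length = p'.pieces.length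
  pieces : ∀ (i : ℕ) (d d' : Designation k N), p.pieces[i]? = some d → p'.pieces[i]? = some d' →
    DesignationSim G d d'

namespace PositionSim

variable {N : ℕ} {G G' : Set (ℤ × ℤ)} {p p' : Position k N}

theorem mono (h : PositionSim G p p') (hG : G ⊆ G') : PositionSim G' p p' :=
  ⟨h.turn, h.length, fun i d d' hd hd' => (h.pieces i d d' hd hd').mono hG⟩

theorem swap (h : PositionSim G p p') : PositionSim (Prod.swap '' G) p' p :=
  ⟨h.turn.symm, h.length.symm, fun i d d' hd hd' => (h.pieces i d' d hd' hd).swap⟩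

theorem exists_piece (h : PositionSim G p p') {i : ℕ} {d : Designation k N}
    (hd : p.pieces[i]? = some d) : ∃ d', p'.pieces[i]? = some d' ∧ DesignationSim G d d' := by
  have hi : i < p'.pieces.length := by
    rw [← h.length]; exact (List.getElem?_eq_some_iff.1 hd).1
  exact ⟨_, List.getElem?_eq_getElem hi, h.pieces i _ _ hd (List.getElem?_eq_getElem hi)⟩

theorem exists_mem (h : PositionSim G p p') {d : Designation k N} (hd : d ∈ p.pieces) :
    ∃ d' ∈ p'.pieces, DesignationSim G d d' := by
  obtain ⟨i, hi⟩ := List.mem_iff_getElem?.1 hd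
  obtain ⟨d', hd', hs⟩ := h.exists_piece hi
  exact ⟨d', List.mem_of_getElem? hd', hs⟩

theorem occupied {M : ℕ} (hM : 2 ≤ M) (hG : Sim M G) (h : PositionSim G p p') {y y' : Square k}
    (hy : SquareSim G y y') (ho : p.Occupied y) : p'.Occupied y' := by
  obtain ⟨d, hd, hl⟩ := ho
  obtain ⟨d', hd', hs⟩ := h.exists_mem hd
  exact ⟨d', hd', (hs.loc_eq_iff hM hG hy).1 hl⟩

theorem after {M : ℕ} (hM : 2 ≤ M) (hG : Sim M G) (h : PositionSim G p p') {y y' : Square k}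
    (hy : SquareSim G y y') (i : ℕ) : PositionSim G (p.after i y) (p'.after i y') := by
  refine ⟨congrArg Color.other h.turn, by simp [Position.after, h.length], fun j e e' he he' => ?_⟩
  simp only [Position.after, List.getElem?_mapIdx, Option.map_eq_some_iff] at he he'
  obtain ⟨d, hd, rfl⟩ := he
  obtain ⟨d', hd', rfl⟩ := he'
  have hs := h.pieces j d d' hd hd'
  have hl := hs.loc_eq_iff hM hG hy
  by_cases hj : j = i
  · simp only [hj, if_true]
    exact ⟨hs.color, hs.kind, .some hy⟩
  · simp only [hj, if_false]
    by_cases hd : d.loc = some y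
    · rw [if_pos hd, if_pos (hl.1 hd)]
      exact ⟨hs.color, hs.kind, .none⟩
    · rw [if_neg hd, if_neg (mt hl.2 hd)]
      exact hs

end PositionSim

/-- The way of moving `μ` allows to go from `x` to `x + m • μ.dir` in the position `p`. -/
def MoveMode.Passes {N : ℕ} (μ : MoveMode k) (p : Position k N) (x : Square k) (m : ℕ) : Prop :=
  1 ≤ m ∧ (m : ℕ∞) ≤ μ.range ∧ ∀ j : ℕ, 0 < j → j < m → ¬ p.Occupied (x + j • μ.dir)

theorem MoveMode.reaches_iff {N : ℕ} (μ : MoveMode k) (p : Position k N) (x y : Square k) :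
    μ.Reaches p x y ↔ ∃ m : ℕ, μ.Passes p x m ∧ y = x + m • μ.dir := by
  unfold MoveMode.Reaches MoveMode.Passes
  exact exists_congr fun m => by tauto

/-! ### Transfer of obstruction, attack, check, moves and wins -/

section Transfer

variable (R : Rules k) {G : Set (ℤ × ℤ)} {p p' : Position k R.numKinds}

theorem squareSim_add {W m m' : ℕ} {G' : Set (ℤ × ℤ)} {x x' v : Square k} (hx : SquareSim G x x')
    (hG' : ∀ g ∈ G, ∀ v : ℤ, v.natAbs + 1 ≤ W → g + v • ((m : ℤ), (m' : ℤ)) ∈ G')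
    (hv : ∀ l, (v l).natAbs + 1 ≤ W) : SquareSim G' (x + m • v) (x' + m' • v) := by
  intro l
  have := hG' _ (hx l) (v l) (hv l)
  simpa [mul_comm] using this

/-- The index `j` of the obstructed square is a quantified number; matching it costs one level. -/
theorem exists_occupied {r : ℕ} (hG : Sim (precision R.width (r + 1)) G) (hp : PositionSim G p p')
    {x x' v : Square k} (hx : SquareSim G x x') (hv : ∀ l, (v l).natAbs + 1 ≤ R.width)
    {m m' : ℕ} (hm : ((m : ℤ), (m' : ℤ)) ∈ G)
    (h : ∃ j : ℕ, 0 < j ∧ j < m ∧ p.Occupied (x + j • v)) :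
    ∃ j : ℕ, 0 < j ∧ j < m' ∧ p'.Occupied (x' + j • v) := by
  obtain ⟨j, hj0, hjm, ho⟩ := h
  have hW := R.two_le_width
  obtain ⟨j', G', hG', hsub, hj, hadd, -⟩ := hG.exists_extension hW j
  have hM : 2 ≤ precision R.width r := hW.trans (le_precision hW r)
  have h1 := (hG' _ ((Comb.single hj).mono (by omega))).2
  have h2 := hG'.lt_iff hM hj (hsub hm)
  refine ⟨j', ?_, ?_, (hp.mono hsub).occupied hM hG' (squareSim_add hx hadd hv) ho⟩
  · simp only at h1; omega
  · simp only at h2; omega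

theorem passes_transfer {r : ℕ} (hG : Sim (precision R.width (r + 1)) G)
    (hp : PositionSim G p p') {x x' : Square k} (hx : SquareSim G x x') {c : Color}
    {t : Fin R.numKinds} {μ : MoveMode k} (hμ : μ ∈ R.moves c t) {m m' : ℕ}
    (hm : ((m : ℤ), (m' : ℤ)) ∈ G) (h : μ.Passes p x m) : μ.Passes p' x' m' := by
  obtain ⟨h1, hr, ho⟩ := h
  have hW := R.two_le_width
  have hM := le_precision hW (r + 1)
  have hc := (hG _ ((Comb.single hm).mono (by omega))).2
  simp only at hc
  refine ⟨by omega, ?_, fun j hj0 hjm hj => ?_⟩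
  · have hle := R.le_width hμ
    generalize μ.range = ρ at hr hle
    induction ρ using ENat.recTopCoe with
    | top => exact le_top
    | coe b =>
      rw [ENat.toNat_natCast] at hle
      have : m ≤ b := by exact_mod_cast hr
      -- A finite range is below the precision, where matched numbers coincide.
      have : m' = m := by omega
      rw [this]; exact hr
  -- An obstruction on the second board is carried back to the first by symmetry.
  · obtain ⟨i, hi0, him, hi⟩ := exists_occupied R hG.swap hp.swap hx.swap
      (R.natAbs_dir_lt_width hμ) ⟨_, hm, rfl⟩ ⟨j, hj0, hjm, hj⟩
    exact ho i hi0 him hi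

theorem attacks_transfer {r : ℕ} (hG : Sim (precision R.width (r + 2)) G)
    (hp : PositionSim G p p') {d d' : Designation k R.numKinds} (hd : DesignationSim G d d')
    {y y' : Square k} (hy : SquareSim G y y') (h : R.Attacks p d y) : R.Attacks p' d' y' := by
  obtain ⟨x, hx, μ, hμ, hc, hr⟩ := h
  obtain ⟨m, hm, rfl⟩ := (μ.reaches_iff p x y).1 hr
  obtain ⟨x', hx', hxs⟩ := hd.exists_loc hx
  have hW := R.two_le_width
  obtain ⟨m', G', hG', hsub, hmm, hadd, -⟩ := hG.exists_extension hW m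
  refine ⟨x', hx', μ, by rwa [← hd.color, ← hd.kind], hc, (μ.reaches_iff _ _ _).2 ⟨m', ?_, ?_⟩⟩
  · exact passes_transfer R hG' (hp.mono hsub) (hxs.mono hsub) hμ hmm hm
  · exact ((hy.mono hsub).eq_iff (hW.trans (le_precision hW _)) hG'
      (squareSim_add hxs hadd (R.natAbs_dir_lt_width hμ))).1 rfl

theorem inCheck_transfer {r : ℕ} (hG : Sim (precision R.width (r + 2)) G)
    (hp : PositionSim G p p') {c : Color} (h : R.InCheck p c) : R.InCheck p' c := by
  obtain ⟨a, ha, hac, hak, s, hs, b, hb, hbc, hat⟩ := h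
  obtain ⟨a', ha', has⟩ := hp.exists_mem ha
  obtain ⟨b', hb', hbs⟩ := hp.exists_mem hb
  obtain ⟨s', hs', hss⟩ := has.exists_loc hs
  exact ⟨a', ha', by rw [← has.color, hac], by rw [← has.kind, hak], s', hs', b', hb',
    by rw [← hbs.color, hbc], attacks_transfer R hG hp hbs hss hat⟩

theorem inCheck_iff {r : ℕ} (hG : Sim (precision R.width (r + 2)) G)
    (hp : PositionSim G p p') (c : Color) : R.InCheck p c ↔ R.InCheck p' c :=
  ⟨inCheck_transfer R hG hp, inCheck_transfer R hG.swap hp.swap⟩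

/-- A legal move, given by the index of the piece, the way of moving and the distance. -/
def Rules.MoveBy (R : Rules k) (p : Position k R.numKinds) (i : ℕ) (μ : MoveMode k) (m : ℕ)
    (q : Position k R.numKinds) : Prop :=
  ∃ (d : Designation k R.numKinds) (x : Square k),
    p.pieces[i]? = some d ∧ d.color = p.turn ∧ d.loc = some x ∧
    μ ∈ R.moves d.color d.kind ∧ μ.Passes p x m ∧
      ((μ.quiet = true ∧ ¬ p.Occupied (x + m • μ.dir)) ∨
        (μ.capture = true ∧
          ∃ e ∈ p.pieces, e.color = d.color.other ∧ e.loc = some (x + m • μ.dir))) ∧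
    q = p.after i (x + m • μ.dir) ∧ ¬ R.InCheck q p.turn

theorem oneMove_iff (q : Position k R.numKinds) :
    R.OneMove p q ↔ ∃ i μ m, R.MoveBy p i μ m q := by
  constructor
  · rintro ⟨i, d, x, y, hd, hc, hx, ⟨μ, hμ, hr, h⟩, hq, hn⟩
    obtain ⟨m, hm, rfl⟩ := (μ.reaches_iff p x y).1 hr
    exact ⟨i, μ, m, d, x, hd, hc, hx, hμ, hm, h, hq, hn⟩
  · rintro ⟨i, μ, m, d, x, hd, hc, hx, hμ, hm, h, hq, hn⟩
    exact ⟨i, d, x, _, hd, hc, hx, ⟨μ, hμ, (μ.reaches_iff p x _).2 ⟨m, hm, rfl⟩, h⟩, hq, hn⟩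

/-- Matching the distance costs one level; the remaining two suffice to compare checks after the
move. The bound on `m'` comes from the extension step and is what makes the game finitely branching.
-/
theorem moveBy_transfer {r : ℕ} (hG : Sim (precision R.width (r + 3)) G)
    (hp : PositionSim G p p') {i : ℕ} {μ : MoveMode k} {m : ℕ} {q : Position k R.numKinds}
    (h : R.MoveBy p i μ m q) :
    ∃ (m' : ℕ) (q' : Position k R.numKinds), R.MoveBy p' i μ m' q' ∧
      (∃ G', Sim (precision R.width (r + 2)) G' ∧ PositionSim G' q q') ∧
      ∀ S : ℕ, (∀ g ∈ G, |g.2| ≤ S) → m' ≤ precision R.width (r + 3) * (S + 1) := by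
  obtain ⟨d, x, hd, hc, hx, hμ, hm, hy, rfl, hn⟩ := h
  have hW := R.two_le_width
  have hM : 2 ≤ precision R.width (r + 2) := hW.trans (le_precision hW _)
  obtain ⟨d', hd', hds⟩ := hp.exists_piece hd
  obtain ⟨x', hx', hxs⟩ := hds.exists_loc hx
  obtain ⟨m', G', hG', hsub, hmm, hadd, hS⟩ := hG.exists_extension hW m
  have hp' := hp.mono hsub
  have hys := squareSim_add hxs hadd (R.natAbs_dir_lt_width hμ)
  have hq := hp'.after hM hG' hys i
  refine ⟨m', _, ⟨d', x', hd', by rw [← hds.color, hc, hp.turn], hx',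
    by rwa [← hds.color, ← hds.kind], passes_transfer R hG' hp' (hxs.mono hsub) hμ hmm hm, ?_,
    rfl, ?_⟩, ⟨G', hG', hq⟩, hS⟩
  · rcases hy with ⟨hq, hy⟩ | ⟨hq, e, he, hec, hel⟩
    · exact .inl ⟨hq, fun ho => hy (hp'.swap.occupied hM hG'.swap hys.swap ho)⟩
    · refine .inr ⟨hq, ?_⟩
      obtain ⟨e', he', hes⟩ := hp'.exists_mem he
      exact ⟨e', he', by rw [← hes.color, hec, hds.color], (hes.loc_eq_iff hM hG' hys).1 hel⟩
  · rw [← hp.turn]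
    exact mt (inCheck_iff R hG' hq _).2 hn

theorem oneMove_transfer {r : ℕ} (hG : Sim (precision R.width (r + 3)) G)
    (hp : PositionSim G p p') {q : Position k R.numKinds} (h : R.OneMove p q) :
    ∃ q', R.OneMove p' q' ∧ ∃ G', Sim (precision R.width (r + 2)) G' ∧ PositionSim G' q q' := by
  obtain ⟨i, μ, m, h⟩ := (oneMove_iff R q).1 h
  obtain ⟨m', q', hq', hG', -⟩ := moveBy_transfer R hG hp h
  exact ⟨q', (oneMove_iff R q').2 ⟨i, μ, m', hq'⟩, hG'⟩

theorem oneMove_transfer_symm {r : ℕ} (hG : Sim (precision R.width (r + 3)) G)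
    (hp : PositionSim G p p') {q' : Position k R.numKinds} (h : R.OneMove p' q') :
    ∃ q, R.OneMove p q ∧ ∃ G', Sim (precision R.width (r + 2)) G' ∧ PositionSim G' q q' := by
  obtain ⟨q, hq, G', hG', hs⟩ := oneMove_transfer R hG.swap hp.swap h
  exact ⟨q, hq, _, hG'.swap, hs.swap⟩

theorem winsIn_transfer (c : Color) (n : ℕ) {G : Set (ℤ × ℤ)} {p p' : Position k R.numKinds}
    (hG : Sim (precision R.width (2 * n + 3)) G) (hp : PositionSim G p p')
    (h : R.WinsIn c n p) : R.WinsIn c n p' := by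
  induction n generalizing G p p' with
  | zero =>
    have hc := inCheck_iff R (r := 1) hG hp
    refine h.imp (fun h => ⟨⟨hp.turn ▸ h.1.1, (hc _).1 h.1.2.1, ?_⟩, mt (hc _).2 h.2⟩)
      fun h => ⟨hp.turn ▸ h.1, (hc _).1 h.2⟩
    rintro ⟨q', hq'⟩
    obtain ⟨q, hq, -⟩ := oneMove_transfer_symm R hG hp hq'
    exact h.1.2.2 ⟨q, hq⟩
  | succ n ih =>
    have hmono := precision_mono R.two_le_width
    refine h.imp (ih (hG.mono (hmono (by omega))) hp) (Or.imp ?_ ?_)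
    · rintro ⟨ht, q, hq, hw⟩
      obtain ⟨q', hq', G', hG', hs⟩ := oneMove_transfer R (r := 2 * n + 2) hG hp hq
      exact ⟨hp.turn ▸ ht, q', hq', ih (hG'.mono (hmono (by omega))) hs hw⟩
    · rintro ⟨ht, hn, ⟨q, hq⟩, hall⟩
      refine ⟨hp.turn ▸ ht, mt (inCheck_iff R (r := 2 * n + 3) hG hp _).2 hn, ?_, ?_⟩
      · obtain ⟨q', hq', -⟩ := oneMove_transfer R (r := 2 * n + 2) hG hp hq
        exact ⟨q', hq'⟩
      · intro q' hq'
        obtain ⟨q, hq, G', hG', hs⟩ := oneMove_transfer_symm R (r := 2 * n + 2) hG hp hq'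
        obtain ⟨s, hs', hw⟩ := hall q hq
        obtain ⟨s', hs'', G'', hG'', hss⟩ := oneMove_transfer R (r := 2 * n + 1) hG' hs hs'
        exact ⟨s', hs'', ih hG'' hss hw⟩

end Transfer

end InfiniteChess

namespace InfiniteChess

variable {k : ℕ}

/-! ### The game with bounded moves -/

/-- The sum of the absolute values of the coordinates. -/
def squareSize (x : Square k) : ℕ := (List.ofFn fun l => (x l).natAbs).sum

theorem natAbs_le_squareSize (x : Square k) (l : Fin k) : (x l).natAbs ≤ squareSize x :=
  List.le_sum_of_mem (List.mem_ofFn.2 ⟨l, rfl⟩)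

/-- The sum of the absolute values of all coordinates of the pieces. -/
def Position.size {N : ℕ} (p : Position k N) : ℕ :=
  (p.pieces.map fun d => (d.loc.map squareSize).getD 0).sum

theorem Position.natAbs_le_size {N : ℕ} (p : Position k N) {d : Designation k N}
    (hd : d ∈ p.pieces) {x : Square k} (hx : d.loc = some x) (l : Fin k) :
    (x l).natAbs ≤ p.size :=
  (natAbs_le_squareSize x l).trans
    (List.le_sum_of_mem (List.mem_map.2 ⟨d, hd, by simp [hx]⟩))

/-- Makes attacks on a given square a bounded search. -/
theorem le_squareSize_of_eq_add {x y v : Square k} (hv : v ≠ 0) {m : ℕ} (h : y = x + m • v) :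
    m ≤ squareSize x + squareSize y := by
  obtain ⟨l, hl⟩ := Function.ne_iff.1 hv
  have hx := natAbs_le_squareSize x l
  have hy := natAbs_le_squareSize y l
  have h1 : y l - x l = m * v l := by rw [h]; simp
  have h2 : (y l - x l).natAbs = m * (v l).natAbs := by rw [h1, Int.natAbs_mul, Int.natAbs_natCast]
  have h3 : m ≤ m * (v l).natAbs := Nat.le_mul_of_pos_right _ (Int.natAbs_pos.2 hl)
  omega

/-- The positions that arise from `p` by a legal move over a distance of at most
`b * (p.size + 1)`. -/
def Rules.BoundedMove (R : Rules k) (b : ℕ) (p q : Position k R.numKinds) : Prop :=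
  ∃ i μ m, m ≤ b * (p.size + 1) ∧ R.MoveBy p i μ m q

theorem Rules.BoundedMove.oneMove {R : Rules k} {b : ℕ} {p q : Position k R.numKinds}
    (h : R.BoundedMove b p q) : R.OneMove p q := by
  obtain ⟨i, μ, m, -, h⟩ := h
  exact (oneMove_iff R q).2 ⟨i, μ, m, h⟩

theorem Rules.exists_boundedMove (R : Rules k) {p q : Position k R.numKinds} (h : R.OneMove p q)
    {r b : ℕ} (hb : precision R.width (r + 3) ≤ b) :
    ∃ q', R.BoundedMove b p q' ∧
      ∃ G, Sim (precision R.width (r + 2)) G ∧ PositionSim G q q' := by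
  obtain ⟨i, μ, m, h⟩ := (oneMove_iff R q).1 h
  -- The position is matched with itself. A diagonal set is similar to every precision, and its
  -- entries are bounded by the size, which bounds the new distance.
  let G : Set (ℤ × ℤ) := {g | g.1 = g.2 ∧ |g.2| ≤ p.size}
  have hG : Sim (precision R.width (r + 3)) G := Sim.diagonal fun g hg => hg.1
  have hp : PositionSim G p p := by
    refine ⟨rfl, rfl, fun j d d' hd hd' => ?_⟩
    obtain rfl : d = d' := Option.some_injective _ (hd.symm.trans hd')
    refine ⟨rfl, rfl, ?_⟩
    cases hx : d.loc with
    | none => exact .none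
    | some x =>
      refine .some fun l => ⟨rfl, ?_⟩
      rw [Int.abs_eq_natAbs]
      exact_mod_cast p.natAbs_le_size (List.mem_of_getElem? hd) hx l
  obtain ⟨m', q', hq', hs, hS⟩ := moveBy_transfer R hG hp h
  exact ⟨q', ⟨i, μ, m', (hS _ fun g hg => hg.2).trans (Nat.mul_le_mul_right _ hb), hq'⟩, hs⟩

/-- The winning condition of the game in which all moves are bounded. -/
def Rules.BoundedWin (R : Rules k) (b : ℕ) (c : Color) : ℕ → Position k R.numKinds → Prop
  | 0, p =>
      (p.turn = c.other ∧ R.InCheck p c.other ∧ (¬ ∃ q, R.BoundedMove b p q) ∧ ¬ R.InCheck p c) ∨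
        (p.turn = c ∧ R.InCheck p c.other)
  | n + 1, p =>
      R.BoundedWin b c n p ∨
      (p.turn = c ∧ ∃ q, R.BoundedMove b p q ∧ R.BoundedWin b c n q) ∨
      (p.turn = c.other ∧ ¬ R.InCheck p c ∧ (∃ q, R.BoundedMove b p q) ∧
        ∀ q, R.BoundedMove b p q → ∃ r, R.BoundedMove b q r ∧ R.BoundedWin b c n r)

theorem Rules.exists_oneMove_iff (R : Rules k) {b : ℕ} (hb : precision R.width 3 ≤ b)
    (p : Position k R.numKinds) : (∃ q, R.OneMove p q) ↔ ∃ q, R.BoundedMove b p q := by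
  constructor
  · rintro ⟨q, hq⟩
    obtain ⟨q', hq', -⟩ := R.exists_boundedMove (r := 0) hq hb
    exact ⟨q', hq'⟩
  · rintro ⟨q, hq⟩
    exact ⟨q, hq.oneMove⟩

theorem Rules.winsIn_iff_boundedWin (R : Rules k) (c : Color) (n : ℕ) {b : ℕ}
    (hb : precision R.width (2 * n + 3) ≤ b) (p : Position k R.numKinds) :
    R.WinsIn c n p ↔ R.BoundedWin b c n p := by
  have hmono := precision_mono R.two_le_width
  induction n generalizing p with
  | zero =>
    simp only [Rules.WinsIn, Rules.BoundedWin, Rules.Mated, R.exists_oneMove_iff hb, and_assoc]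
  | succ n ih =>
    have ih : ∀ p, R.WinsIn c n p ↔ R.BoundedWin b c n p := ih ((hmono (by omega)).trans hb)
    have hmove : ∀ q, (∃ r, R.OneMove q r ∧ R.WinsIn c n r) ↔
        ∃ r, R.BoundedMove b q r ∧ R.BoundedWin b c n r := by
      intro q
      constructor
      · rintro ⟨r, hr, hw⟩
        obtain ⟨r', hr', G, hG, hs⟩ := R.exists_boundedMove (r := 2 * n + 2) hr hb
        exact ⟨r', hr', (ih r').1 (winsIn_transfer R c n (hG.mono (hmono (by omega))) hs hw)⟩
      · rintro ⟨r, hr, hw⟩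
        exact ⟨r, hr.oneMove, (ih r).2 hw⟩
    simp only [Rules.WinsIn, Rules.BoundedWin]
    rw [ih p, hmove p, R.exists_oneMove_iff ((hmono (by omega)).trans hb)]
    simp only [hmove]
    refine or_congr_right (or_congr_right (and_congr_right fun _ => and_congr_right fun _ =>
      and_congr_right fun _ => ⟨fun h q hq => h q hq.oneMove, fun h q hq => ?_⟩))
    -- An arbitrary reply `q` is answered by replacing it with a similar bounded reply `q'` and
    -- transferring the winning answer to `q'` back to `q`.
    obtain ⟨q', hq', G, hG, hs⟩ := R.exists_boundedMove (r := 2 * n + 2) hq hb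
    obtain ⟨r', hr', hw⟩ := h q' hq'
    obtain ⟨r, hr, G', hG', hs'⟩ :=
      oneMove_transfer_symm R (r := 2 * n + 1) hG hs hr'.oneMove
    rw [← hmove]
    exact ⟨r, hr, winsIn_transfer R c n hG'.swap hs'.swap ((ih r').2 hw)⟩

end InfiniteChess

/-! ### Primitive recursive helpers -/

namespace PrimrecPred

variable {α β : Type*} [Primcodable α] [Primcodable β]

theorem exists_mem {f : α → List β} {P : α → β → Prop} (hf : Primrec f)
    (hP : PrimrecPred fun x : α × β => P x.1 x.2) : PrimrecPred fun a => ∃ b ∈ f a, P a b := by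
  have h : PrimrecRel fun (b : β) (a : α) => P a b :=
    (hP.comp (Primrec.pair Primrec.snd Primrec.fst)).primrecRel
  exact (PrimrecRel.exists_mem_list h).comp hf Primrec.id

theorem forall_mem {f : α → List β} {P : α → β → Prop} (hf : Primrec f)
    (hP : PrimrecPred fun x : α × β => P x.1 x.2) : PrimrecPred fun a => ∀ b ∈ f a, P a b :=
  (exists_mem (P := fun a b => ¬ P a b) hf hP.not).not.of_eq fun a => by simp

theorem exists_eq_some {f : α → Option β} {P : α → β → Prop} (hf : Primrec f)
    (hP : PrimrecPred fun x : α × β => P x.1 x.2) :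
    PrimrecPred fun a => ∃ b, f a = some b ∧ P a b :=
  (exists_mem (Primrec.optionToList.comp hf) hP).of_eq fun a => by simp

theorem exists_lt' {f : α → ℕ} {P : α → ℕ → Prop} (hf : Primrec f)
    (hP : PrimrecPred fun x : α × ℕ => P x.1 x.2) : PrimrecPred fun a => ∃ m < f a, P a m :=
  (exists_mem (Primrec.list_range.comp hf) hP).of_eq fun a => by simp

theorem forall_lt' {f : α → ℕ} {P : α → ℕ → Prop} (hf : Primrec f)
    (hP : PrimrecPred fun x : α × ℕ => P x.1 x.2) : PrimrecPred fun a => ∀ m < f a, P a m :=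
  (forall_mem (Primrec.list_range.comp hf) hP).of_eq fun a => by simp

theorem eq_fun {f g : α → β} (hf : Primrec f) (hg : Primrec g) :
    PrimrecPred fun a => f a = g a :=
  Primrec.eq.comp hf hg

theorem of_finite [Finite α] (P : α → Prop) : PrimrecPred P := by
  classical
  exact ⟨inferInstance, Primrec.dom_finite _⟩

end PrimrecPred

namespace Primrec

variable {α β γ : Type*} [Primcodable α] [Primcodable β] [Primcodable γ]

theorem list_mapIdx {f : α → List β} {g : α × ℕ × β → γ} (hf : Primrec f) (hg : Primrec g) :
    Primrec fun a => (f a).mapIdx fun j b => g (a, j, b) := by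
  have h : Primrec₂ fun (a : α) (j : ℕ) => ((f a)[j]?).map fun b => g (a, j, b) :=
    option_map (list_getElem?.comp (hf.comp fst) snd)
      (hg.comp (pair (fst.comp fst) (pair (snd.comp fst) snd))).to₂
  refine (listFilterMap (list_range.comp (list_length.comp hf)) h).of_eq fun a => ?_
  have key : ∀ n ≤ (f a).length,
      (List.range n).filterMap (fun j => ((f a)[j]?).map fun b => g (a, j, b)) =
        ((f a).mapIdx fun j b => g (a, j, b)).take n := by
    intro n hn
    induction n with
    | zero => simp
    | succ n ih =>
      rw [List.range_succ, List.filterMap_append, ih (by omega), List.take_add_one]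
      simp [List.getElem?_eq_getElem (show n < (f a).length by omega)]
  rw [key _ le_rfl, List.take_of_length_le (by simp)]

theorem list_sum : Primrec (List.sum : List ℕ → ℕ) :=
  (list_foldr (f := fun l : List ℕ => l) (g := fun _ => 0) (h := fun _ x => x.1 + x.2)
    Primrec.id (const 0) (nat_add.comp (fst.comp snd) (snd.comp snd)).to₂).of_eq fun _ => rfl

theorem nat_factorial : Primrec Nat.factorial :=
  (nat_rec₁ 1 (nat_mul.comp (succ.comp fst) snd).to₂).of_eq fun n => by
    induction n with
    | zero => rfl
    | succ n ih => rw [Nat.factorial_succ, ← ih]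

/-- Nonnegative integers have even codes and negative ones odd codes, so parity and halving recover
the value. -/
theorem int_toNat : Primrec Int.toNat := by
  refine (cond (nat_bodd.comp Primrec.encode) (const 0) (nat_div2.comp Primrec.encode)).of_eq
    fun z => ?_
  cases z with
  | ofNat n =>
    rw [show Encodable.encode (Int.ofNat n) = 2 * n from rfl]
    simp [Nat.div2_val]
  | negSucc n =>
    rw [show Encodable.encode (Int.negSucc n) = 2 * n + 1 from rfl]
    simp

theorem int_toNat_neg : Primrec fun z : ℤ => (-z).toNat := by
  refine (cond (nat_bodd.comp Primrec.encode) (succ.comp (nat_div2.comp Primrec.encode))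
    (const 0)).of_eq fun z => ?_
  cases z with
  | ofNat n =>
    rw [show Encodable.encode (Int.ofNat n) = 2 * n from rfl]
    simp
  | negSucc n =>
    rw [show Encodable.encode (Int.negSucc n) = 2 * n + 1 from rfl]
    simp [Nat.div2_val, Int.neg_negSucc]

theorem int_natAbs : Primrec Int.natAbs :=
  (nat_add.comp int_toNat int_toNat_neg).of_eq fun z => by omega

theorem int_natCast : Primrec fun n : ℕ => (n : ℤ) :=
  encode_iff.1 (nat_double.of_eq fun _ => rfl)

theorem int_negSucc : Primrec Int.negSucc :=
  encode_iff.1 (nat_double_succ.of_eq fun _ => rfl)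

theorem int_natCast_sub : Primrec₂ fun m n : ℕ => (m : ℤ) - n := by
  refine (ite (nat_le.comp snd fst) (int_natCast.comp (nat_sub.comp fst snd))
    (int_negSucc.comp (nat_sub.comp (pred.comp snd) fst))).to₂.of_eq fun m n => ?_
  simp only
  split_ifs with h
  · omega
  · rw [Int.negSucc_eq]; simp only [Nat.pred_eq_sub_one]; omega

/-- Integers are split into differences of naturals, which reduces the arithmetic to ℕ. -/
theorem int_add_natCast_mul :
    Primrec fun t : ℤ × ℕ × ℤ => t.1 + (t.2.1 : ℤ) * t.2.2 := by
  have hm : Primrec fun t : ℤ × ℕ × ℤ => t.2.1 := fst.comp snd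
  have hv : Primrec fun t : ℤ × ℕ × ℤ => t.2.2 := snd.comp snd
  refine (int_natCast_sub.comp
    (nat_add.comp (int_toNat.comp fst) (nat_mul.comp hm (int_toNat.comp hv)))
    (nat_add.comp (int_toNat_neg.comp fst) (nat_mul.comp hm (int_toNat_neg.comp hv)))).of_eq
    fun t => ?_
  obtain ⟨x, m, v⟩ := t
  have h1 : x = (x.toNat : ℤ) - (-x).toNat := by omega
  have h2 : v = (v.toNat : ℤ) - (-v).toNat := by omega
  conv_rhs => rw [h1, h2]
  push_cast
  ring

end Primrec

namespace InfiniteChess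

variable {k N : ℕ}

/-! ### Computability of the bounded game -/

open Primrec

instance : Finite Color := Finite.of_equiv Bool Color.equivBool.symm

theorem Color.primrec_other : Primrec Color.other := Primrec.dom_finite _

theorem Designation.primrec_equivProd : Primrec (Designation.equivProd k N) := Primrec.of_equiv

theorem Designation.primrec_color : Primrec (Designation.color : Designation k N → Color) :=
  fst.comp Designation.primrec_equivProd

theorem Designation.primrec_kind : Primrec (Designation.kind : Designation k N → Fin N) :=
  fst.comp (snd.comp Designation.primrec_equivProd)

theorem Designation.primrec_loc :
    Primrec (Designation.loc : Designation k N → Option (Square k)) :=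
  snd.comp (snd.comp Designation.primrec_equivProd)

theorem Designation.primrec_mk :
    Primrec fun t : Color × Fin N × Option (Square k) => Designation.mk t.1 t.2.1 t.2.2 :=
  Primrec.of_equiv_symm (e := Designation.equivProd k N)

theorem Position.primrec_equivProd : Primrec (Position.equivProd k N) := Primrec.of_equiv

theorem Position.primrec_pieces :
    Primrec (Position.pieces : Position k N → List (Designation k N)) :=
  fst.comp Position.primrec_equivProd

theorem Position.primrec_turn : Primrec (Position.turn : Position k N → Color) :=
  snd.comp Position.primrec_equivProd

theorem Position.primrec_mk :
    Primrec fun t : List (Designation k N) × Color => Position.mk t.1 t.2 :=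
  Primrec.of_equiv_symm (e := Position.equivProd k N)

theorem primrec_squareSize : Primrec (squareSize : Square k → ℕ) :=
  list_sum.comp (list_ofFn fun l => int_natAbs.comp (fin_app.comp Primrec.id (const l)))

theorem Position.primrec_size : Primrec (Position.size : Position k N → ℕ) :=
  list_sum.comp (list_map Position.primrec_pieces
    (option_getD.comp (option_map (Designation.primrec_loc.comp snd)
      (primrec_squareSize.comp snd).to₂) (const 0)).to₂)

theorem Position.primrecPred_occupied :
    PrimrecPred fun t : Position k N × Square k => t.1.Occupied t.2 :=
  PrimrecPred.exists_mem (Position.primrec_pieces.comp fst)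
    (PrimrecPred.eq_fun (Designation.primrec_loc.comp snd) (option_some.comp (snd.comp fst)))

theorem Position.primrec_after :
    Primrec fun t : Position k N × ℕ × Square k => t.1.after t.2.1 t.2.2 := by
  classical
  have hd : Primrec fun t : (Position k N × ℕ × Square k) × ℕ × Designation k N => t.2.2 :=
    snd.comp snd
  have hy : Primrec fun t : (Position k N × ℕ × Square k) × ℕ × Designation k N =>
      some t.1.2.2 := option_some.comp (snd.comp (snd.comp fst))
  have hc := Designation.primrec_color.comp hd
  have hk := Designation.primrec_kind.comp hd
  have hl := Designation.primrec_loc.comp hd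
  have h := list_mapIdx (Position.primrec_pieces.comp
      (fst : Primrec fun t : Position k N × ℕ × Square k => t.1))
    (ite (PrimrecPred.eq_fun (fst.comp snd) (fst.comp (snd.comp fst)))
      (Designation.primrec_mk.comp (pair hc (pair hk hy)))
      (ite (PrimrecPred.eq_fun hl hy)
        (Designation.primrec_mk.comp (pair hc (pair hk (const none)))) hd))
  refine (Position.primrec_mk.comp (pair h
    (Color.primrec_other.comp (Position.primrec_turn.comp fst)))).of_eq fun t => ?_
  simp only [Position.after]

/-- All ways of moving that occur in the rules. -/
def Rules.modes (R : Rules k) : List (MoveMode k) :=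
  (List.finRange R.numKinds).flatMap fun t => R.moves .white t ++ R.moves .black t

theorem Rules.mem_modes (R : Rules k) {c : Color} {t : Fin R.numKinds} {μ : MoveMode k}
    (h : μ ∈ R.moves c t) : μ ∈ R.modes := by
  refine List.mem_flatMap.2 ⟨t, List.mem_finRange t, ?_⟩
  cases c <;> simp [h]

/-- A way of moving, given by its index. -/
def Rules.mode (R : Rules k) (a : Fin R.modes.length) : MoveMode k := R.modes[a]

theorem Rules.exists_mode (R : Rules k) {c : Color} {t : Fin R.numKinds} {μ : MoveMode k}
    (h : μ ∈ R.moves c t) : ∃ a, R.mode a = μ := by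
  obtain ⟨i, hi, rfl⟩ := List.getElem_of_mem (R.mem_modes h)
  exact ⟨⟨i, hi⟩, rfl⟩

/-! ### Bounded search for attacks and legal moves -/

section

variable (R : Rules k)

theorem primrecPred_mode_mem : PrimrecPred fun t : Fin R.modes.length × Color × Fin R.numKinds =>
    R.mode t.1 ∈ R.moves t.2.1 t.2.2 :=
  PrimrecPred.of_finite _

/-- Moving along a direction of the rules is primitive recursive. -/
theorem primrec_add_nsmul_dir : Primrec fun t : Square k × ℕ × Fin R.modes.length =>
    t.1 + t.2.1 • (R.mode t.2.2).dir := by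
  refine fin_curry.2 ?_
  have hdir : Primrec fun t : Fin R.modes.length × Fin k => (R.mode t.1).dir t.2 :=
    dom_finite _
  refine (int_add_natCast_mul.comp (pair (fin_app.comp (fst.comp fst) snd)
    (pair (fst.comp (snd.comp fst)) (hdir.comp (pair (snd.comp (snd.comp fst)) snd))))).to₂.of_eq
    fun t l => ?_
  simp

theorem primrecPred_range : PrimrecPred fun t : ℕ × Fin R.modes.length =>
    (t.1 : ℕ∞) ≤ (R.mode t.2).range := by
  have h1 : Primrec fun a : Fin R.modes.length => (R.mode a).range.toNat := dom_finite _
  have h2 : PrimrecPred fun a : Fin R.modes.length => (R.mode a).range = ⊤ :=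
    PrimrecPred.of_finite _
  -- Infinite range is a separate case because `toNat` sends `⊤` to `0`.
  refine ((h2.comp snd).or (nat_le.comp fst (h1.comp snd))).of_eq fun t => ?_
  generalize (R.mode t.2).range = ρ
  induction ρ using ENat.recTopCoe with
  | top => simp
  | coe b => simp

theorem primrecPred_passes :
    PrimrecPred fun t : Position k R.numKinds × Square k × ℕ × Fin R.modes.length =>
      (R.mode t.2.2.2).Passes t.1 t.2.1 t.2.2.1 := by
  have hm : Primrec fun t : Position k R.numKinds × Square k × ℕ × Fin R.modes.length =>
      t.2.2.1 := fst.comp (snd.comp snd)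
  refine (nat_le.comp (const 1) hm).and (((primrecPred_range R).comp (snd.comp snd)).and
    (PrimrecPred.of_eq (PrimrecPred.forall_lt' hm
      (P := fun t j => j = 0 ∨ ¬ t.1.Occupied (t.2.1 + j • (R.mode t.2.2.2).dir))
      ((PrimrecPred.eq_fun snd (const 0)).or
      (Position.primrecPred_occupied.comp (pair (fst.comp fst)
        ((primrec_add_nsmul_dir R).comp (pair (fst.comp (snd.comp fst))
          (pair snd (snd.comp (snd.comp (snd.comp fst)))))))).not)) fun t => ?_))
  refine forall_congr' fun j => ?_
  rcases Nat.eq_zero_or_pos j with rfl | hj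
  · simp
  · simp [hj, hj.ne']

theorem attacks_iff (p : Position k R.numKinds) (d : Designation k R.numKinds) (y : Square k) :
    R.Attacks p d y ↔ ∃ x, d.loc = some x ∧ ∃ a ∈ List.finRange R.modes.length,
      R.mode a ∈ R.moves d.color d.kind ∧ (R.mode a).capture = true ∧
      ∃ m < squareSize x + squareSize y + 1, (R.mode a).Passes p x m ∧
        y = x + m • (R.mode a).dir := by
  refine exists_congr fun x => and_congr_right fun _ => ?_
  constructor
  · rintro ⟨μ, hμ, hc, hr⟩
    obtain ⟨a, rfl⟩ := R.exists_mode hμ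
    obtain ⟨m, hm, hy⟩ := (MoveMode.reaches_iff _ p x y).1 hr
    exact ⟨a, List.mem_finRange a, hμ, hc, m,
      Nat.lt_succ_of_le (le_squareSize_of_eq_add (R.mode a).dir_ne_zero hy), hm, hy⟩
  · rintro ⟨a, -, hμ, hc, m, -, hm, hy⟩
    exact ⟨_, hμ, hc, (MoveMode.reaches_iff _ p x y).2 ⟨m, hm, hy⟩⟩

theorem primrecPred_attacks :
    PrimrecPred fun t : Position k R.numKinds × Designation k R.numKinds × Square k =>
      R.Attacks t.1 t.2.1 t.2.2 := by
  refine PrimrecPred.of_eq ?_ fun t => (attacks_iff R t.1 t.2.1 t.2.2).symm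
  have hcap : PrimrecPred fun a : Fin R.modes.length => (R.mode a).capture = true :=
    PrimrecPred.of_finite _
  refine PrimrecPred.exists_eq_some (Designation.primrec_loc.comp (fst.comp snd)) ?_
  refine PrimrecPred.exists_mem (const _) ?_
  have hp : Primrec fun t : ((Position k R.numKinds × Designation k R.numKinds × Square k) ×
    Square k) × Fin R.modes.length => t.1.1.1 := fst.comp (fst.comp fst)
  have hd : Primrec fun t : ((Position k R.numKinds × Designation k R.numKinds × Square k) ×
    Square k) × Fin R.modes.length => t.1.1.2.1 := fst.comp (snd.comp (fst.comp fst))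
  have hy : Primrec fun t : ((Position k R.numKinds × Designation k R.numKinds × Square k) ×
    Square k) × Fin R.modes.length => t.1.1.2.2 := snd.comp (snd.comp (fst.comp fst))
  have hx : Primrec fun t : ((Position k R.numKinds × Designation k R.numKinds × Square k) ×
    Square k) × Fin R.modes.length => t.1.2 := snd.comp fst
  have hpass := (primrecPred_passes R).comp (pair (hp.comp (fst (β := ℕ)))
      (pair (hx.comp fst) (pair snd (snd.comp fst))))
  have heq := PrimrecPred.eq_fun (hy.comp (fst (β := ℕ))) ((primrec_add_nsmul_dir R).comp
      (pair (hx.comp fst) (pair snd (snd.comp fst))))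
  exact ((primrecPred_mode_mem R).comp (pair snd (pair (Designation.primrec_color.comp hd)
    (Designation.primrec_kind.comp hd)))).and ((hcap.comp snd).and
    (PrimrecPred.exists_lt' (succ.comp (nat_add.comp (primrec_squareSize.comp hx)
    (primrec_squareSize.comp hy))) (hpass.and heq)))

theorem primrecPred_inCheck :
    PrimrecPred fun t : Position k R.numKinds × Color => R.InCheck t.1 t.2 := by
  refine PrimrecPred.exists_mem (Position.primrec_pieces.comp fst) ?_
  refine (PrimrecPred.eq_fun (Designation.primrec_color.comp snd) (snd.comp fst)).and
    ((PrimrecPred.eq_fun (Designation.primrec_kind.comp snd) (const _)).and ?_)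
  refine PrimrecPred.exists_eq_some (Designation.primrec_loc.comp snd) ?_
  refine PrimrecPred.exists_mem (Position.primrec_pieces.comp (fst.comp (fst.comp fst))) ?_
  refine (PrimrecPred.eq_fun (Designation.primrec_color.comp snd)
    (Color.primrec_other.comp (snd.comp (fst.comp (fst.comp fst))))).and ?_
  exact (primrecPred_attacks R).comp (pair (fst.comp (fst.comp (fst.comp fst)))
    (pair snd (snd.comp fst)))

/-- The square to which the `i`-th piece is moved. -/
def destination (p : Position k R.numKinds) (i : ℕ) (a : Fin R.modes.length) (m : ℕ) : Square k :=
  ((p.pieces[i]?).bind Designation.loc).getD 0 + m • (R.mode a).dir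

/-- The position after such a move. -/
def target (p : Position k R.numKinds) (t : ℕ × Fin R.modes.length × ℕ) :
    Position k R.numKinds :=
  p.after t.1 (destination R p t.1 t.2.1 t.2.2)

theorem primrec_destination :
    Primrec fun t : Position k R.numKinds × ℕ × Fin R.modes.length × ℕ =>
      destination R t.1 t.2.1 t.2.2.1 t.2.2.2 :=
  (primrec_add_nsmul_dir R).comp (pair (option_getD.comp (option_bind (list_getElem?.comp
    (Position.primrec_pieces.comp fst) (fst.comp snd)) (Designation.primrec_loc.comp snd).to₂)
    (const 0)) (pair (snd.comp (snd.comp snd)) (fst.comp (snd.comp snd))))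

theorem primrec_target :
    Primrec fun t : Position k R.numKinds × ℕ × Fin R.modes.length × ℕ => target R t.1 t.2 :=
  Position.primrec_after.comp (pair fst (pair (fst.comp snd) (primrec_destination R)))

/-- Moving the given piece by the given way and distance is legal. -/
def IsLegal (p : Position k R.numKinds) (t : ℕ × Fin R.modes.length × ℕ) : Prop :=
  (∃ d, p.pieces[t.1]? = some d ∧ (d.color = p.turn ∧ (∃ x, d.loc = some x ∧
      (R.mode t.2.1).Passes p x t.2.2) ∧ R.mode t.2.1 ∈ R.moves d.color d.kind ∧
    (((R.mode t.2.1).quiet = true ∧ ¬ p.Occupied (destination R p t.1 t.2.1 t.2.2)) ∨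
      ((R.mode t.2.1).capture = true ∧ ∃ e ∈ p.pieces, e.color = d.color.other ∧
        e.loc = some (destination R p t.1 t.2.1 t.2.2))))) ∧
    ¬ R.InCheck (target R p t) p.turn

/-- A legal move is determined by index, mode and distance. The default square in `destination`
never matters, since legality requires a live piece at that index. -/
theorem moveBy_mode_iff {p q : Position k R.numKinds} {i : ℕ} {a : Fin R.modes.length} {m : ℕ} :
    R.MoveBy p i (R.mode a) m q ↔ IsLegal R p (i, a, m) ∧ q = target R p (i, a, m) := by
  constructor
  · rintro ⟨d, x, hd, hc, hx, hμ, hm, hy, rfl, hn⟩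
    have hdest : destination R p i a m = x + m • (R.mode a).dir := by simp [destination, hd, hx]
    refine ⟨⟨⟨d, hd, hc, ⟨x, hx, hm⟩, hμ, ?_⟩, ?_⟩, ?_⟩
    · simpa only [hdest] using hy
    · simpa only [target, hdest] using hn
    · simp only [target, hdest]
  · rintro ⟨⟨⟨d, hd, hc, ⟨x, hx, hm⟩, hμ, hy⟩, hn⟩, rfl⟩
    simp only at hd hm hμ hy
    have hdest : destination R p i a m = x + m • (R.mode a).dir := by simp [destination, hd, hx]
    refine ⟨d, x, hd, hc, hx, hμ, hm, ?_, ?_, hn⟩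
    · simpa only [hdest] using hy
    · simp only [target, hdest]

theorem primrecPred_isLegal :
    PrimrecPred fun t : Position k R.numKinds × ℕ × Fin R.modes.length × ℕ =>
      IsLegal R t.1 t.2 := by
  have hquiet : PrimrecPred fun a : Fin R.modes.length => (R.mode a).quiet = true :=
    PrimrecPred.of_finite _
  have hcap : PrimrecPred fun a : Fin R.modes.length => (R.mode a).capture = true :=
    PrimrecPred.of_finite _
  refine PrimrecPred.and ?_ ((primrecPred_inCheck R).comp
    (pair (primrec_target R) (Position.primrec_turn.comp fst))).not
  refine PrimrecPred.exists_eq_some (list_getElem?.comp (Position.primrec_pieces.comp fst)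
    (fst.comp snd)) ?_
  have hp : Primrec fun t : (Position k R.numKinds × ℕ × Fin R.modes.length × ℕ) ×
    Designation k R.numKinds => t.1.1 := fst.comp fst
  have ha : Primrec fun t : (Position k R.numKinds × ℕ × Fin R.modes.length × ℕ) ×
    Designation k R.numKinds => t.1.2.2.1 := fst.comp (snd.comp (snd.comp fst))
  have hm : Primrec fun t : (Position k R.numKinds × ℕ × Fin R.modes.length × ℕ) ×
    Designation k R.numKinds => t.1.2.2.2 := snd.comp (snd.comp (snd.comp fst))
  have hdest := (primrec_destination R).comp (fst (β := Designation k R.numKinds))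
  have hcol : Primrec fun t : (Position k R.numKinds × ℕ × Fin R.modes.length × ℕ) ×
    Designation k R.numKinds => t.2.color := Designation.primrec_color.comp snd
  refine (PrimrecPred.eq_fun hcol (Position.primrec_turn.comp hp)).and (PrimrecPred.and ?_
    (((primrecPred_mode_mem R).comp (pair ha (pair hcol (Designation.primrec_kind.comp snd)))).and
      (((hquiet.comp ha).and (Position.primrecPred_occupied.comp (pair hp hdest)).not).or
        ((hcap.comp ha).and ?_))))
  · exact PrimrecPred.exists_eq_some (Designation.primrec_loc.comp snd)
      ((primrecPred_passes R).comp (pair (hp.comp fst) (pair snd (pair (hm.comp fst)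
        (ha.comp fst)))))
  · exact PrimrecPred.exists_mem (Position.primrec_pieces.comp hp)
      ((PrimrecPred.eq_fun (Designation.primrec_color.comp snd)
        (Color.primrec_other.comp (hcol.comp fst))).and
        (PrimrecPred.eq_fun (Designation.primrec_loc.comp snd)
          (option_some.comp (hdest.comp fst))))

/-- The index, the way of moving and the distance of the moves that have to be considered. -/
def candidates (b : ℕ) (p : Position k R.numKinds) : List (ℕ × Fin R.modes.length × ℕ) :=
  (List.range p.pieces.length).flatMap fun i => (List.finRange R.modes.length).flatMap fun a =>
    (List.range (b * (p.size + 1) + 1)).map fun m => (i, a, m)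

theorem primrec_candidates :
    Primrec fun t : ℕ × Position k R.numKinds => candidates R t.1 t.2 := by
  have h : Primrec₂ fun (t : (ℕ × Position k R.numKinds) × ℕ) (a : Fin R.modes.length) =>
      (List.range (t.1.1 * (t.1.2.size + 1) + 1)).map fun m => (t.2, a, m) :=
    (list_map (list_range.comp (succ.comp (nat_mul.comp (fst.comp (fst.comp fst))
      (succ.comp (Position.primrec_size.comp (snd.comp (fst.comp fst)))))))
      (pair (snd.comp (fst.comp fst)) (pair (snd.comp fst) snd)).to₂).to₂
  exact list_flatMap (list_range.comp (list_length.comp (Position.primrec_pieces.comp snd)))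
    (list_flatMap (const (List.finRange R.modes.length)) h).to₂

open Classical in
/-- The list of the positions that arise by a bounded legal move. -/
noncomputable def successors (b : ℕ) (p : Position k R.numKinds) : List (Position k R.numKinds) :=
  (candidates R b p).flatMap fun t => if IsLegal R p t then [target R p t] else []

theorem primrec_successors :
    Primrec fun t : ℕ × Position k R.numKinds => successors R t.1 t.2 := by
  classical
  refine list_flatMap (primrec_candidates R) ?_
  have h : Primrec fun t : (ℕ × Position k R.numKinds) × ℕ × Fin R.modes.length × ℕ =>
      (t.1.2, t.2) := pair (snd.comp fst) snd
  exact (ite ((primrecPred_isLegal R).comp h) (list_cons.comp ((primrec_target R).comp h)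
    (const [])) (const [])).to₂

theorem mem_successors {b : ℕ} {p q : Position k R.numKinds} :
    q ∈ successors R b p ↔ R.BoundedMove b p q := by
  simp only [successors, List.mem_flatMap, candidates, List.mem_map, List.mem_range,
    Rules.BoundedMove]
  constructor
  · rintro ⟨-, ⟨i, hi, a, -, m, hm, rfl⟩, hq⟩
    split_ifs at hq with h
    · exact ⟨i, _, m, by omega, (moveBy_mode_iff R).2 ⟨h, by simpa using hq⟩⟩
    · simp at hq
  · rintro ⟨i, μ, m, hm, h⟩
    obtain ⟨d, x, hd, -, -, hμ, -⟩ := id h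
    obtain ⟨a, rfl⟩ := R.exists_mode hμ
    obtain ⟨hl, rfl⟩ := (moveBy_mode_iff R).1 h
    exact ⟨_, ⟨i, (List.getElem?_eq_some_iff.1 hd).1, a, List.mem_finRange a, m, by omega, rfl⟩,
      by simp [hl]⟩

end

end InfiniteChess

namespace InfiniteChess

/-! ### Recursive evaluation of the bounded game -/

open Primrec

variable {k : ℕ} (R : Rules k)

/-- `BoundedWin`, or with the flag set, a bounded move to a position with `BoundedWin`. -/
def gameValue (s : ℕ × Color) (t : Bool × ℕ × Position k R.numKinds) : Prop :=
  if t.1 then ∃ q, R.BoundedMove s.1 t.2.2 q ∧ R.BoundedWin s.1 s.2 t.2.1 q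
  else R.BoundedWin s.1 s.2 t.2.1 t.2.2

/-- The instances to which `gameValue` is reduced. -/
noncomputable def subgames (s : ℕ × Color) (t : Bool × ℕ × Position k R.numKinds) :
    List (Bool × ℕ × Position k R.numKinds) :=
  if t.1 = true then (successors R s.1 t.2.2).map fun q => (false, t.2.1, q)
  else if t.2.1 = 0 then []
  else (false, t.2.1.pred, t.2.2) :: (true, t.2.1.pred, t.2.2) ::
    (successors R s.1 t.2.2).map fun q => (true, t.2.1.pred, q)

theorem primrec_subgames : Primrec₂ (subgames R) := by
  have hs : Primrec fun x : (ℕ × Color) × Bool × ℕ × Position k R.numKinds =>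
      successors R x.1.1 x.2.2.2 :=
    (primrec_successors R).comp (pair (fst.comp fst) (snd.comp (snd.comp snd)))
  have hn : Primrec fun x : (ℕ × Color) × Bool × ℕ × Position k R.numKinds => x.2.2.1 :=
    fst.comp (snd.comp snd)
  have hp : Primrec fun x : (ℕ × Color) × Bool × ℕ × Position k R.numKinds => x.2.2.2 :=
    snd.comp (snd.comp snd)
  have hn' := pred.comp hn
  exact (ite (PrimrecPred.eq_fun (fst.comp snd) (const true))
    (list_map hs (pair (const false) (pair (hn.comp fst) snd)).to₂)
    (ite (PrimrecPred.eq_fun hn (const 0)) (const [])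
      (list_cons.comp (pair (const false) (pair hn' hp))
        (list_cons.comp (pair (const true) (pair hn' hp))
          (list_map hs (pair (const true) (pair (hn'.comp fst) snd)).to₂))))).to₂

/-- The positions that are decided without looking at subgames. -/
def baseWin (s : ℕ × Color) (p : Position k R.numKinds) : Prop :=
  (p.turn = s.2.other ∧ R.InCheck p s.2.other ∧ successors R s.1 p = [] ∧ ¬ R.InCheck p s.2) ∨
    (p.turn = s.2 ∧ R.InCheck p s.2.other)

/-- The recursive step in the evaluation of a position: `L` lists the values of the subgames. -/
def stepWin (s : ℕ × Color) (p : Position k R.numKinds) (L : List Bool) : Prop :=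
  L[0]? = some true ∨ (p.turn = s.2 ∧ L[1]? = some true) ∨
    (p.turn = s.2.other ∧ ¬ R.InCheck p s.2 ∧ successors R s.1 p ≠ [] ∧ ∀ e ∈ L.drop 2, e = true)

/-- The value of a game in terms of the values of the subgames. -/
def evaluate (s : ℕ × Color) (x : (Bool × ℕ × Position k R.numKinds) × List Bool) : Prop :=
  (x.1.1 = true ∧ ∃ e ∈ x.2, e = true) ∨
    (x.1.1 = false ∧ ((x.1.2.1 = 0 ∧ baseWin R s x.1.2.2) ∨
      (x.1.2.1 ≠ 0 ∧ stepWin R s x.1.2.2 x.2)))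

theorem primrecPred_baseWin :
    PrimrecPred fun t : (ℕ × Color) × Position k R.numKinds => baseWin R t.1 t.2 := by
  have ht : Primrec fun t : (ℕ × Color) × Position k R.numKinds => t.2.turn :=
    Position.primrec_turn.comp snd
  have hc : Primrec fun t : (ℕ × Color) × Position k R.numKinds => t.1.2 := snd.comp fst
  have ho := Color.primrec_other.comp hc
  have hco := (primrecPred_inCheck R).comp (pair snd ho)
  exact ((PrimrecPred.eq_fun ht ho).and (hco.and ((PrimrecPred.eq_fun
    ((primrec_successors R).comp (pair (fst.comp fst) snd)) (const [])).and
      ((primrecPred_inCheck R).comp (pair snd hc)).not))).or ((PrimrecPred.eq_fun ht hc).and hco)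

theorem primrecPred_stepWin :
    PrimrecPred fun t : (ℕ × Color) × Position k R.numKinds × List Bool =>
      stepWin R t.1 t.2.1 t.2.2 := by
  have hp : Primrec fun t : (ℕ × Color) × Position k R.numKinds × List Bool => t.2.1 :=
    fst.comp snd
  have hL : Primrec fun t : (ℕ × Color) × Position k R.numKinds × List Bool => t.2.2 :=
    snd.comp snd
  have hc : Primrec fun t : (ℕ × Color) × Position k R.numKinds × List Bool => t.1.2 :=
    snd.comp fst
  have ht := Position.primrec_turn.comp hp
  have hsucc := (primrec_successors R).comp (pair (fst.comp fst) hp)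
  have hget : ∀ i, PrimrecPred fun t : (ℕ × Color) × Position k R.numKinds × List Bool =>
      t.2.2[i]? = some true := fun i =>
    PrimrecPred.eq_fun (list_getElem?.comp hL (const i)) (const _)
  exact (hget 0).or (((PrimrecPred.eq_fun ht hc).and (hget 1)).or
    ((PrimrecPred.eq_fun ht (Color.primrec_other.comp hc)).and
      (((primrecPred_inCheck R).comp (pair hp hc)).not.and
        ((PrimrecPred.eq_fun hsucc (const [])).not.and
          (PrimrecPred.forall_mem (list_drop.comp (const 2) hL)
            (PrimrecPred.eq_fun snd (const true)))))))

theorem primrecPred_evaluate :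
    PrimrecPred fun t : (ℕ × Color) × (Bool × ℕ × Position k R.numKinds) × List Bool =>
      evaluate R t.1 t.2 := by
  have htag : Primrec fun t : (ℕ × Color) × (Bool × ℕ × Position k R.numKinds) × List Bool =>
      t.2.1.1 := fst.comp (fst.comp snd)
  have hn : Primrec fun t : (ℕ × Color) × (Bool × ℕ × Position k R.numKinds) × List Bool =>
      t.2.1.2.1 := fst.comp (snd.comp (fst.comp snd))
  have hp : Primrec fun t : (ℕ × Color) × (Bool × ℕ × Position k R.numKinds) × List Bool =>
      t.2.1.2.2 := snd.comp (snd.comp (fst.comp snd))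
  have hL : Primrec fun t : (ℕ × Color) × (Bool × ℕ × Position k R.numKinds) × List Bool =>
      t.2.2 := snd.comp snd
  have h0 := PrimrecPred.eq_fun hn (const 0)
  exact ((PrimrecPred.eq_fun htag (const true)).and (PrimrecPred.exists_mem hL
      (PrimrecPred.eq_fun snd (const true)))).or
    ((PrimrecPred.eq_fun htag (const false)).and
      ((h0.and ((primrecPred_baseWin R).comp (pair fst hp))).or
        (h0.not.and ((primrecPred_stepWin R).comp (pair fst (pair hp hL))))))

theorem successors_eq_nil_iff {b : ℕ} {p : Position k R.numKinds} :
    successors R b p = [] ↔ ¬ ∃ q, R.BoundedMove b p q := by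
  rw [List.eq_nil_iff_forall_not_mem, not_exists]
  exact forall_congr' fun q => not_congr (mem_successors R)

open Classical in
-- The order of `subgames` matters: entry 0 is the same position with one move fewer, entry 1 asks
-- for a winning move of the player, and the entries from 2 on are the opponent's replies.
theorem evaluate_iff (s : ℕ × Color) (t : Bool × ℕ × Position k R.numKinds) :
    evaluate R s (t, (subgames R s t).map fun t => decide (gameValue R s t)) ↔
      gameValue R s t := by
  obtain ⟨b, c⟩ := s
  obtain ⟨tag, n, p⟩ := t
  cases tag with
  | true => simp [evaluate, subgames, gameValue, mem_successors]
  | false =>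
    cases n with
    | zero => simp [evaluate, gameValue, baseWin, Rules.BoundedWin, successors_eq_nil_iff]
    | succ n =>
      simp [evaluate, gameValue, stepWin, subgames, Rules.BoundedWin, successors_eq_nil_iff,
        mem_successors]

theorem primrecPred_boundedWin :
    PrimrecPred fun t : (ℕ × Color) × ℕ × Position k R.numKinds =>
      R.BoundedWin t.1.1 t.1.2 t.2.1 t.2.2 := by
  classical
  have h : Primrec₂ fun s t => decide (gameValue R s t) := by
    -- A flagged instance with `n` lies strictly between the unflagged ones with `n` and `n + 1`, so
    -- the measure drops at every call.
    refine nat_omega_rec _ (m := fun _ t => 2 * t.2.1 + if t.1 = true then 1 else 0)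
      (l := subgames R) (g := fun s x => some (decide (evaluate R s x))) ?_ (primrec_subgames R)
      ?_ ?_ ?_
    · exact (nat_add.comp (nat_double.comp (fst.comp (snd.comp snd)))
        (ite (PrimrecPred.eq_fun (fst.comp snd) (const true)) (const 1) (const 0))).to₂
    · exact (option_some.comp (primrecPred_evaluate R).decide).to₂
    · rintro s ⟨tag, n, p⟩ t' ht'
      cases tag with
      | true =>
        simp only [subgames, if_true, List.mem_map] at ht'
        obtain ⟨q, -, rfl⟩ := ht'
        simp
      | false =>
        cases n with
        | zero => simp [subgames] at ht'
        | succ n =>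
          simp only [subgames, Bool.false_eq_true, if_false, Nat.succ_ne_zero, Nat.pred_succ,
            List.mem_cons, List.mem_map] at ht'
          rcases ht' with rfl | rfl | ⟨q, -, rfl⟩ <;> simp <;> omega
    · intro s t
      simp only [evaluate_iff]
  refine ⟨inferInstance, (h.comp fst (pair (const false) snd)).of_eq fun t => ?_⟩
  simp [gameValue]

/-! ### The distance bound, genuine positions and the decision procedure -/

theorem primrec_refine : Primrec refine := by
  have h2 : Primrec fun n : ℕ => 2 * n * n := nat_mul.comp nat_double Primrec.id
  exact nat_add.comp (nat_add.comp h2 (nat_mul.comp (nat_mul.comp Primrec.id Primrec.id)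
    nat_factorial)) Primrec.id

theorem primrec_precision (W : ℕ) : Primrec (precision W) :=
  (nat_rec₁ W (primrec_refine.comp (nat_mul.comp (const W) snd)).to₂).of_eq fun n => by
    induction n with
    | zero => rfl
    | succ n ih => rw [precision, ← ih]

/-- Replaces the quantifier over all squares by a comparison of locations, leaving only bounded
quantifiers. -/
theorem isPosition_iff (p : Position k R.numKinds) : R.IsPosition p ↔
    ∀ i < p.pieces.length, ∀ j < i, ∀ d ∈ (p.pieces[j]?).toList, ∀ e ∈ (p.pieces[i]?).toList,
      ¬ (d.kind = R.king ∧ e.kind = R.king ∧ d.color = e.color) ∧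
        ¬ (d.loc = e.loc ∧ d.loc ≠ none) := by
  have hloc : ∀ d e : Designation k R.numKinds,
      (∀ s, ¬ (d.loc = some s ∧ e.loc = some s)) ↔ ¬ (d.loc = e.loc ∧ d.loc ≠ none) := by
    intro d e
    generalize d.loc = o, e.loc = o'
    cases o <;> simp [eq_comm]
  simp only [Rules.IsPosition, List.pairwise_iff_getElem, hloc]
  constructor
  · rintro ⟨h1, h2⟩ i hi j hj d hd e he
    rw [Option.mem_toList, List.getElem?_eq_some_iff] at hd he
    obtain ⟨_, rfl⟩ := hd
    obtain ⟨_, rfl⟩ := he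
    exact ⟨h1 j i _ _ hj, h2 j i _ _ hj⟩
  · intro h
    refine ⟨fun j i hj hi hji => (h i hi j hji _ ?_ _ ?_).1,
      fun j i hj hi hji => (h i hi j hji _ ?_ _ ?_).2⟩ <;>
    simp [hj, hi]

theorem primrecPred_isPosition : PrimrecPred R.IsPosition := by
  refine PrimrecPred.of_eq ?_ fun p => (isPosition_iff R p).symm
  refine PrimrecPred.forall_lt' (list_length.comp Position.primrec_pieces) ?_
  refine PrimrecPred.forall_lt' snd ?_
  refine PrimrecPred.forall_mem (optionToList.comp (list_getElem?.comp
    (Position.primrec_pieces.comp (fst.comp fst)) snd)) ?_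
  refine PrimrecPred.forall_mem (optionToList.comp (list_getElem?.comp
    (Position.primrec_pieces.comp (fst.comp (fst.comp fst))) (snd.comp (fst.comp fst)))) ?_
  have hd := snd.comp (fst (α := ((Position k R.numKinds × ℕ) × ℕ) × Designation k R.numKinds)
    (β := Designation k R.numKinds))
  have he := snd (α := ((Position k R.numKinds × ℕ) × ℕ) × Designation k R.numKinds)
    (β := Designation k R.numKinds)
  exact ((PrimrecPred.eq_fun (Designation.primrec_kind.comp hd) (const _)).and
    ((PrimrecPred.eq_fun (Designation.primrec_kind.comp he) (const _)).and
      (PrimrecPred.eq_fun (Designation.primrec_color.comp hd)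
        (Designation.primrec_color.comp he)))).not.and
    ((PrimrecPred.eq_fun (Designation.primrec_loc.comp hd) (Designation.primrec_loc.comp he)).and
      (PrimrecPred.eq_fun (Designation.primrec_loc.comp hd) (const none)).not).not

/-- The distance bound is computed from `n` as part of the input, which gives uniformity in `n`. The
bounded game decides wins for arbitrary listings, so being a genuine position is tested separately.
-/
theorem primrecPred_mateIn : PrimrecPred R.MateIn := by
  have hn : Primrec fun x : Position k R.numKinds × Color × ℕ => x.2.2 := snd.comp snd
  have hb : Primrec fun x : Position k R.numKinds × Color × ℕ =>
      precision R.width (2 * x.2.2 + 3) :=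
    (primrec_precision R.width).comp (nat_add.comp (nat_double.comp hn) (const 3))
  refine (((primrecPred_isPosition R).comp fst).and ((primrecPred_boundedWin R).comp
    (pair (pair hb (fst.comp snd)) (pair hn fst)))).of_eq fun x => ?_
  exact and_congr_right fun _ => (R.winsIn_iff_boundedWin _ _ le_rfl _).symm

end InfiniteChess

theorem mainTheorem3 (k : ℕ) (R : InfiniteChess.Rules k) :
    ComputablePred R.MateIn :=
  (InfiniteChess.primrecPred_mateIn R).computablePred
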